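/- **Theorem 1.1.** Let $\rho\in C_0^\infty(\mathbb R^3)$ be real valued and radial, $\rho(x)=\rho_r(|x|)$, with $\rho(x)=0$ for $|x|\ge R_\rho$ and total charge $\int\rho\,d^3x=e\in\mathbb R$ (condition (C)), and let the bare mass be $m_{\mathrm b}>0$. Let $\phi_{\mathrm{ex}}\in C^\infty(\mathbb R^3)$ and $A_{\mathrm{ex}}\in C^\infty(\mathbb R^3,\mathbb R^3)$ be such that $\phi_{\mathrm{ex}}$ is bounded below and all derivatives of order $1,2,3$ of $\phi_{\mathrm{ex}}$ and of $A_{\mathrm{ex}}$ are bounded (condition (P)). Put $E_{\mathrm{ex}}=-\nabla\phi_{\mathrm{ex}}$, $B_{\mathrm{ex}}=\nabla\times A_{\mathrm{ex}}$, and $\gamma(v)=(1-|v|^2)^{-1/2}$ for $|v|<1$. Let $\mathcal M$ be the set of all $Y=(E,B,q,v)$ with $E,B\in L^2(\mathbb R^3,\mathbb R^3)$, $q\in\mathbb R^3$, $v\in\mathbb R^3$, $|v|<1$, that satisfy $\nabla\cdot E=\rho(\cdot-q)$ and $\nabla\cdot B=0$ in the sense of distributions, with the metric $$d(Y_1,Y_2)=\|E_1-E_2\|_{L^2}+\|B_1-B_2\|_{L^2}+|q_1-q_2|+|\gamma(v_1)v_1-\gamma(v_2)v_2|.$$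 Then for every $Y^0=(E^0,B^0,q^0,v^0)\in\mathcal M$ there is exactly one continuous map $\mathbb R\to\mathcal M$, $t\mapsto Y(t)=(E(t),B(t),q(t),v(t))$, that satisfies for all $t\in\mathbb R$ the time-integrated equations of motion $$B(t)=B^0-\int_0^t\nabla\times E(s)\,ds,\qquad E(t)=E^0+\int_0^t\big(\nabla\times B(s)-\rho(\cdot-q(s))\,v(s)\big)\,ds,$$ $$q(t)=q^0+\int_0^t v(s)\,ds,$$ $$m_{\mathrm b}\gamma(v(t))v(t)=m_{\mathrm b}\gamma(v^0)v^0+\int_0^t\!\int\rho(x-q(s))\big[E_{\mathrm{ex}}(x)+v(s)\times B_{\mathrm{ex}}(x)+E(x,s)+v(s)\times B(x,s)\big]\,d^3x\,ds,$$ where the two field equations hold in the sense of distributions, i.e. after integration against an arbitrary $\psi\in C_0^\infty(\mathbb R^3,\mathbb R^3)$, with $\int\psi\cdot(\nabla\times F):=\int(\nabla\times\psi)\cdot F$ under the time integral. Moreover $Y(0)=Y^0$, and the energy $$\mathcal E(E,B,q,v)=m_{\mathrm b}\gamma(v)+(\phi_{\mathrm{ex}}*\rho)(q)+\tfrac12\int\big(|E(x)|^2+|B(x)|^2\big)\,d^3x$$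 is conserved: $\mathcal E(Y(t))=\mathcal E(Y^0)$ for all $t\in\mathbb R$. -/

import Mathlib

open MeasureTheory
open scoped ContDiff

namespace AbrahamModel

noncomputable section

/-- Physical space `ℝ³` with its Euclidean norm. -/
abbrev E3 : Type := EuclideanSpace ℝ (Fin 3)

/-- The real Hilbert space `L²(ℝ³, ℝ³)`. -/
abbrev L2Field : Type := Lp E3 2 (volume : Measure E3)

/-- The vector product on `ℝ³`. -/
def cross (a b : E3) : E3 := WithLp.toLp 2 (crossProduct a.ofLp b.ofLp)

/-- The partial derivative `∂ᵢ Fⱼ` of a vector field `F`. -/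
def partialD (i j : Fin 3) (F : E3 → E3) (x : E3) : ℝ :=
  fderiv ℝ F x (EuclideanSpace.single i 1) j

/-- The classical curl `∇ × F` of a (differentiable) vector field. -/
def curl (F : E3 → E3) (x : E3) : E3 :=
  !₂[partialD 1 2 F x - partialD 2 1 F x,
     partialD 2 0 F x - partialD 0 2 F x,
     partialD 0 1 F x - partialD 1 0 F x]

/-- The `L²` pairing `∫ F(x) · G(x) dx` of two vector fields. -/
def pairing (F G : E3 → E3) : ℝ := ∫ x, inner ℝ (F x) (G x)

/-- Test functions: smooth with compact support. -/
def IsTest {V : Type*} [NormedAddCommGroup V] [NormedSpace ℝ V] (f : E3 → V) : Prop :=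
  ContDiff ℝ ∞ f ∧ HasCompactSupport f

/-- `∇ · F = g` in the sense of distributions: `-∫ ∇f · F = ∫ f g` for all test functions. -/
def HasWeakDiv (F : E3 → E3) (g : E3 → ℝ) : Prop :=
  ∀ f : E3 → ℝ, IsTest f → -pairing (gradient f) F = ∫ x, f x * g x

/-- The relativistic factor `γ(v) = (1 - |v|²)^{-1/2}`. -/
def gammaFactor (v : E3) : ℝ := 1 / Real.sqrt (1 - ‖v‖ ^ 2)

/-- States `Y = (E, B, q, v)` of finite norm: square integrable fields, a position and a
velocity of modulus less than `1` (the speed of light). -/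
@[ext]
structure State where
  E : L2Field
  B : L2Field
  q : E3
  v : E3
  v_lt : ‖v‖ < 1

/-- The relativistic velocity variable `γ(v) v` of a state. -/
def State.u (Y : State) : E3 := gammaFactor Y.v • Y.v

theorem gammaFactor_pos {v : E3} (hv : ‖v‖ < 1) : 0 < gammaFactor v := by
  unfold gammaFactor
  have : 0 < 1 - ‖v‖ ^ 2 := by nlinarith [norm_nonneg v]
  positivity

theorem gammaFactor_sq {v : E3} (hv : ‖v‖ < 1) :
    gammaFactor v ^ 2 = 1 + ‖gammaFactor v • v‖ ^ 2 := by
  have h : 0 < 1 - ‖v‖ ^ 2 := by nlinarith [norm_nonneg v]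
  rw [norm_smul, mul_pow, Real.norm_eq_abs, sq_abs]
  unfold gammaFactor
  rw [div_pow, Real.sq_sqrt h.le]
  field_simp
  ring

theorem gammaFactor_smul_injective {v w : E3} (hv : ‖v‖ < 1) (hw : ‖w‖ < 1)
    (h : gammaFactor v • v = gammaFactor w • w) : v = w := by
  have hg : gammaFactor v = gammaFactor w := by
    have h2 : gammaFactor v ^ 2 = gammaFactor w ^ 2 := by
      rw [gammaFactor_sq hv, gammaFactor_sq hw, h]
    exact (pow_left_inj₀ (gammaFactor_pos hv).le (gammaFactor_pos hw).le two_ne_zero).1 h2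
  rw [hg] at h
  exact smul_right_injective E3 (gammaFactor_pos hw).ne' h

/-- The metric
`d(Y₁, Y₂) = ‖E₁ - E₂‖ + ‖B₁ - B₂‖ + |q₁ - q₂| + |γ(v₁) v₁ - γ(v₂) v₂|`. -/
instance instMetricSpaceState : MetricSpace State where
  dist Y₁ Y₂ := ‖Y₁.E - Y₂.E‖ + ‖Y₁.B - Y₂.B‖ + ‖Y₁.q - Y₂.q‖ + ‖Y₁.u - Y₂.u‖
  dist_self Y := by simp
  dist_comm Y₁ Y₂ := by
    rw [norm_sub_rev Y₁.E, norm_sub_rev Y₁.B, norm_sub_rev Y₁.q, norm_sub_rev Y₁.u]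
  dist_triangle Y₁ Y₂ Y₃ := by
    have h1 := norm_sub_le_norm_sub_add_norm_sub Y₁.E Y₂.E Y₃.E
    have h2 := norm_sub_le_norm_sub_add_norm_sub Y₁.B Y₂.B Y₃.B
    have h3 := norm_sub_le_norm_sub_add_norm_sub Y₁.q Y₂.q Y₃.q
    have h4 := norm_sub_le_norm_sub_add_norm_sub Y₁.u Y₂.u Y₃.u
    linarith
  eq_of_dist_eq_zero := by
    intro Y₁ Y₂ h
    change ‖Y₁.E - Y₂.E‖ + ‖Y₁.B - Y₂.B‖ + ‖Y₁.q - Y₂.q‖ + ‖Y₁.u - Y₂.u‖ = 0 at h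
    have h1 := norm_nonneg (Y₁.E - Y₂.E)
    have h2 := norm_nonneg (Y₁.B - Y₂.B)
    have h3 := norm_nonneg (Y₁.q - Y₂.q)
    have h4 := norm_nonneg (Y₁.u - Y₂.u)
    apply State.ext
    · exact sub_eq_zero.1 (norm_eq_zero.1 (by linarith))
    · exact sub_eq_zero.1 (norm_eq_zero.1 (by linarith))
    · exact sub_eq_zero.1 (norm_eq_zero.1 (by linarith))
    · have hu : Y₁.u = Y₂.u := sub_eq_zero.1 (norm_eq_zero.1 (by linarith))
      exact gammaFactor_smul_injective Y₁.v_lt Y₂.v_lt hu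

/-- Condition `(C)`: the charge distribution `ρ` is smooth, radial, vanishes for `|x| ≥ R`
and has total charge `e` (of either sign). -/
structure ConditionC (ρ : E3 → ℝ) (R e : ℝ) : Prop where
  smooth : ContDiff ℝ ∞ ρ
  radial : ∃ ρr : ℝ → ℝ, ∀ x, ρ x = ρr ‖x‖
  support : ∀ x, R ≤ ‖x‖ → ρ x = 0
  charge : ∫ x, ρ x = e

/-- Condition `(P)`: the external potentials `φ`, `A` are smooth, `φ` is bounded below, and
the derivatives of order `1, 2, 3` of `φ` and `A` are bounded. -/
structure ConditionP (φ : E3 → ℝ) (A : E3 → E3) : Prop where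
  smooth_phi : ContDiff ℝ ∞ φ
  smooth_A : ContDiff ℝ ∞ A
  bddBelow_phi : ∃ c : ℝ, ∀ x, c ≤ φ x
  bounded : ∃ C : ℝ, ∀ k : ℕ, 1 ≤ k → k ≤ 3 → ∀ x,
    ‖iteratedFDeriv ℝ k φ x‖ ≤ C ∧ ‖iteratedFDeriv ℝ k A x‖ ≤ C

/-- The phase space `𝓜`: states with `∇ · E = ρ(· - q)` and `∇ · B = 0`. It carries the
metric of `State`. -/
def phaseSpace (ρ : E3 → ℝ) : Set State :=
  {Y | HasWeakDiv Y.E (fun x => ρ (x - Y.q)) ∧ HasWeakDiv Y.B (fun _ => 0)}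

/-- The external electric field `-∇φ`. -/
def extE (φ : E3 → ℝ) (x : E3) : E3 := -gradient φ x

/-- The external magnetic field `∇ × A`. -/
def extB (A : E3 → E3) (x : E3) : E3 := curl A x

/-- The Lorentz force on the charge distribution,
`∫ ρ(x - q) [E_ex(x) + v × B_ex(x) + E(x) + v × B(x)] dx`. -/
def force (ρ φ : E3 → ℝ) (A : E3 → E3) (Y : State) : E3 :=
  ∫ x, ρ (x - Y.q) •
    (extE φ x + cross Y.v (extB A x) + Y.E x + cross Y.v (Y.B x))

/-- The current density `ρ(x - q) v`. -/
def current (ρ : E3 → ℝ) (Y : State) (x : E3) : E3 := ρ (x - Y.q) • Y.v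

/-- `Y` is a solution, for all times `t ∈ ℝ`, of the time-integrated equations of motion
`Y(t) = Y⁰ + ∫₀ᵗ F(Y(s)) ds`, where `Y' = F(Y)` stands for
`∂ₜB = -∇ × E`, `∂ₜE = ∇ × B - ρ(x - q) v`, `q' = v` and `(m γ(v) v)' = force`.
As the fields are merely square integrable, the curls are taken in the sense of distributions,
that is, the field equations are tested against smooth compactly supported vector fields. -/
structure SolvesIntegrated (ρ : E3 → ℝ) (m : ℝ) (φ : E3 → ℝ) (A : E3 → E3)
    (Y₀ : State) (Y : ℝ → State) : Prop where
  faraday : ∀ t : ℝ, ∀ ψ : E3 → E3, IsTest ψ →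
    pairing ψ (Y t).B = pairing ψ Y₀.B + ∫ s in (0 : ℝ)..t, -pairing (curl ψ) (Y s).E
  ampere : ∀ t : ℝ, ∀ ψ : E3 → E3, IsTest ψ →
    pairing ψ (Y t).E = pairing ψ Y₀.E +
      ∫ s in (0 : ℝ)..t, (pairing (curl ψ) (Y s).B - pairing ψ (current ρ (Y s)))
  position : ∀ t : ℝ, (Y t).q = Y₀.q + ∫ s in (0 : ℝ)..t, (Y s).v
  momentum : ∀ t : ℝ, m • gammaFactor (Y t).v • (Y t).v =
    m • gammaFactor Y₀.v • Y₀.v + ∫ s in (0 : ℝ)..t, force ρ φ A (Y s)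

/-- The energy
`m γ(v) + (φ ∗ ρ)(q) + ½ ∫ (|E|² + |B|²)`. -/
def energy (ρ : E3 → ℝ) (m : ℝ) (φ : E3 → ℝ) (Y : State) : ℝ :=
  m * gammaFactor Y.v + (∫ y, φ (Y.q - y) * ρ y) + (1 / 2) * ∫ x, (‖Y.E x‖ ^ 2 + ‖Y.B x‖ ^ 2)

end

end AbrahamModel

/-!
Well-posedness and energy conservation for the Abraham model: a rigid charge with velocity
`|v| < 1`, coupled to the Maxwell field it generates and to external potentials.

The free Maxwell operator `(E, B) ↦ (∇ × B, -∇ × E)` is skew on test fields. Its compositions with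
mollifiers are bounded, skew, and commute with each other, and their exponentials converge strongly
to a group `U(t)` of isometries of `L² × L²` (`SkewApprox.U`). That weak solutions, tested only
against smooth compactly supported fields, are unique rests on the mollifier as well: the time
integral of a weak solution lies in the domain of the maximal operator, hence the mollified solution
is differentiable in norm and has constant norm (`SkewApprox.eq_zero_of_weak`). Consequently weak
solutions with a source `J` are exactly the functions `U(t) G(t)` with `G' = U(-t) J`
(`SkewApprox.hasDerivAt_inner_U`, `SkewApprox.eq_duhamel_of_weak`).

In the interaction picture, with the variables `G = U(-t) (E, B)`, `q` and `u = γ(v) v`, no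
unbounded operator is left, and the equations of motion form an ordinary differential equation in
the Banach space `(L² × L²) × ℝ³ × ℝ³`. Since `ρ` is smooth and compactly supported and the
derivatives of the potentials are bounded, its right-hand side is Lipschitz on bounded sets. The
rates of `G` and `q` are bounded, because `|v| < 1`, and the rate of `u` grows at most linearly in
`G`; this yields unique global solutions (`GlobalODE.exists_global`, `GlobalODE.unique`). As `G` is
differentiable in norm, the energy can be differentiated directly, and the power of the Lorentz
force cancels the change of the field energy and of the potential energy (`energy_conserved`).
Gauss' law persists because the divergence constraint is tested with gradients, which have no curl
(`toState_mem_phaseSpace`).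
-/

/-! ### Unitary groups generated by skew operators with commuting regularizations -/

namespace SkewEvolution

open Filter Topology

variable {H : Type*} [NormedAddCommGroup H] [InnerProductSpace ℝ H]

/-- A bounded operator on a real Hilbert space that equals minus its adjoint. -/
def IsSkew (A : H →L[ℝ] H) : Prop := ∀ x y, inner ℝ (A x) y = -inner ℝ x (A y)

theorem IsSkew.inner_self {A : H →L[ℝ] H} (hA : IsSkew A) (x : H) : inner ℝ (A x) x = 0 := by
  have h := hA x x
  rw [real_inner_comm (A x) x] at h
  linarith

/-- A densely defined skew-symmetric operator `e i ↦ a i`, given on a family of test vectors `e`,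
together with bounded regularizations: `S n` tends strongly to the identity and `A n` is the
operator composed with `S n`. The last field says that the graph of the maximal (weak) extension
of the operator is mapped to itself by `S n`. -/
structure SkewApprox (H ι : Type*) [NormedAddCommGroup H] [InnerProductSpace ℝ H] where
  e : ι → H
  a : ι → H
  S : ℕ → H →L[ℝ] H
  A : ℕ → H →L[ℝ] H
  total : ∀ f, (∀ i, inner ℝ (e i) f = 0) → f = 0
  S_symm : ∀ n x y, inner ℝ (S n x) y = inner ℝ x (S n y)
  S_tendsto : ∀ x, Tendsto (fun n => S n x) atTop (𝓝 x)
  A_skew : ∀ n, IsSkew (A n)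
  A_e : ∀ n i, A n (e i) = S n (a i)
  A_S : ∀ n m x, A n (S m x) = S m (A n x)
  graph_S : ∀ f g, (∀ i, inner ℝ (e i) g = -inner ℝ (a i) f) →
    ∀ n i, inner ℝ (e i) (S n g) = -inner ℝ (a i) (S n f)

namespace SkewApprox

variable {ι : Type*} (P : SkewApprox H ι)

/-- On the graph of the weak operator the regularized operator acts as the regularization of the
weak operator. -/
theorem S_eq_A {f g : H} (h : ∀ i, inner ℝ (P.e i) g = -inner ℝ (P.a i) f) (n : ℕ) :
    P.S n g = P.A n f := by
  rw [← sub_eq_zero]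
  apply P.total
  intro i
  have h1 : inner ℝ (P.e i) (P.A n f) = -inner ℝ (P.a i) (P.S n f) := by
    rw [← P.S_symm, ← P.A_e, P.A_skew, neg_neg]
  rw [inner_sub_right, P.graph_S f g h n i, h1, sub_self]

theorem A_S_swap (n m : ℕ) (x : H) : P.A n (P.S m x) = P.A m (P.S n x) := by
  rw [P.A_S]
  apply P.S_eq_A
  intro i
  rw [← P.S_symm, ← P.A_e, P.A_skew, neg_neg]

theorem commute_A (n m : ℕ) : Commute (P.A n) (P.A m) := by
  apply ContinuousLinearMap.ext
  intro x
  change P.A n (P.A m x) = P.A m (P.A n x)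
  rw [← sub_eq_zero]
  apply P.total
  intro i
  have h1 : inner ℝ (P.e i) (P.A n (P.A m x)) = inner ℝ (P.A m (P.A n (P.e i))) x := by
    rw [P.A_skew, P.A_skew, neg_neg]
  have h2 : inner ℝ (P.e i) (P.A m (P.A n x)) = inner ℝ (P.A n (P.A m (P.e i))) x := by
    rw [P.A_skew, P.A_skew, neg_neg]
  rw [inner_sub_right, h1, h2, P.A_e, P.A_e, P.A_S_swap, sub_self]

/-- The vectors on which the regularized operators converge. -/
def domain : Submodule ℝ H where
  carrier := {x | ∃ y, Tendsto (fun n => P.A n x) atTop (𝓝 y)}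
  add_mem' := by
    rintro x y ⟨x', hx⟩ ⟨y', hy⟩
    exact ⟨x' + y', by simpa using hx.add hy⟩
  zero_mem' := ⟨0, by simp⟩
  smul_mem' := by
    rintro c x ⟨x', hx⟩
    exact ⟨c • x', by simpa using hx.const_smul c⟩

theorem tendsto_A_e (i : ι) : Tendsto (fun n => P.A n (P.e i)) atTop (𝓝 (P.a i)) := by
  simpa only [P.A_e] using P.S_tendsto (P.a i)

end SkewApprox

variable [CompleteSpace H]

theorem hasDerivAt_exp_apply (A : H →L[ℝ] H) (x : H) (t : ℝ) :
    HasDerivAt (fun s : ℝ => NormedSpace.exp (s • A) x) (A (NormedSpace.exp (t • A) x)) t := by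
  have h := hasDerivAt_exp_smul_const' (𝕂 := ℝ) A t
  simpa using h.clm_apply (hasDerivAt_const t x)

theorem hasDerivAt_exp_apply' (A : H →L[ℝ] H) (x : H) (t : ℝ) :
    HasDerivAt (fun s : ℝ => NormedSpace.exp (s • A) x) (NormedSpace.exp (t • A) (A x)) t := by
  have h := hasDerivAt_exp_smul_const (𝕂 := ℝ) A t
  simpa using h.clm_apply (hasDerivAt_const t x)

theorem IsSkew.norm_exp_apply {A : H →L[ℝ] H} (hA : IsSkew A) (t : ℝ) (x : H) :
    ‖NormedSpace.exp (t • A) x‖ = ‖x‖ := by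
  have hd : ∀ s : ℝ, HasDerivAt (fun s : ℝ => ‖NormedSpace.exp (s • A) x‖ ^ 2) 0 s := by
    intro s
    have h := (hasDerivAt_exp_apply A x s).norm_sq
    rw [real_inner_comm, hA.inner_self, mul_zero] at h
    exact h
  have h := is_const_of_deriv_eq_zero (fun s => (hd s).differentiableAt)
    (fun s => (hd s).deriv) t 0
  simp only [zero_smul, NormedSpace.exp_zero, one_apply_eq_self] at h
  exact (pow_left_inj₀ (norm_nonneg _) (norm_nonneg _) two_ne_zero).1 h

theorem IsSkew.norm_exp_apply_sub_le {A : H →L[ℝ] H} (hA : IsSkew A) (t : ℝ) (x : H) :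
    ‖NormedSpace.exp (t • A) x - x‖ ≤ ‖A x‖ * |t| := by
  have h := Convex.norm_image_sub_le_of_norm_hasDerivWithin_le (s := Set.univ)
    (f := fun s : ℝ => NormedSpace.exp (s • A) x) (x := 0) (y := t) (C := ‖A x‖)
    (fun s _ => (hasDerivAt_exp_apply' A x s).hasDerivWithinAt)
    (fun s _ => (hA.norm_exp_apply s _).le) convex_univ trivial trivial
  simpa using h

theorem exp_add_apply (A : H →L[ℝ] H) (s t : ℝ) (x : H) :
    NormedSpace.exp ((s + t) • A) x = NormedSpace.exp (s • A) (NormedSpace.exp (t • A) x) := by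
  let _ : NormedAlgebra ℚ (H →L[ℝ] H) := NormedAlgebra.restrictScalars ℚ ℝ _
  rw [add_smul, NormedSpace.exp_add_of_commute]
  · rfl
  · exact ((Commute.refl A).smul_left s).smul_right t

theorem IsSkew.norm_exp_sub_exp_time_le {A : H →L[ℝ] H} (hA : IsSkew A) (s t : ℝ) (x : H) :
    ‖NormedSpace.exp (t • A) x - NormedSpace.exp (s • A) x‖ ≤ ‖A x‖ * |t - s| := by
  have h : t = s + (t - s) := by ring
  rw [h, exp_add_apply, ← map_sub, hA.norm_exp_apply, ← h]
  exact hA.norm_exp_apply_sub_le _ _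

/-- Two commuting skew operators generate flows that differ, on a vector `x`, by no more than the
generators do on that same `x`. -/
theorem norm_exp_sub_exp_le {A B : H →L[ℝ] H} (hA : IsSkew A) (hB : IsSkew B)
    (hAB : Commute A B) (t : ℝ) (x : H) :
    ‖NormedSpace.exp (t • B) x - NormedSpace.exp (t • A) x‖ ≤ ‖B x - A x‖ * |t| := by
  let _ : NormedAlgebra ℚ (H →L[ℝ] H) := NormedAlgebra.restrictScalars ℚ ℝ _
  have hBA : IsSkew (B - A) := by
    intro x y
    simp only [sub_apply, inner_sub_left, inner_sub_right, hA x y, hB x y]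
    ring
  have h1 : t • B = t • A + t • (B - A) := by rw [← smul_add]; congr 1; abel
  have hc : Commute (t • A) (t • (B - A)) :=
    ((hAB.sub_right (Commute.refl A)).smul_left t).smul_right t
  rw [h1, NormedSpace.exp_add_of_commute hc, mul_apply_eq_comp, ← map_sub, hA.norm_exp_apply]
  simpa using hBA.norm_exp_apply_sub_le t x

namespace SkewApprox

variable {ι : Type*} (P : SkewApprox H ι)

theorem dense_domain : Dense (P.domain : Set H) := by
  rw [Submodule.dense_iff_topologicalClosure_eq_top, Submodule.topologicalClosure_eq_top_iff,
    Submodule.eq_bot_iff]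
  intro x hx
  apply P.total
  intro i
  exact (Submodule.mem_orthogonal _ _).1 hx _ ⟨_, P.tendsto_A_e i⟩

theorem cauchySeq_exp (t : ℝ) (x : H) :
    CauchySeq (fun n => NormedSpace.exp (t • P.A n) x) := by
  rw [Metric.cauchySeq_iff']
  intro ε hε
  obtain ⟨d, ⟨y, hy⟩, hxd⟩ := P.dense_domain.exists_dist_lt x (show 0 < ε / 4 by positivity)
  obtain ⟨N, hN⟩ := Metric.cauchySeq_iff'.1 hy.cauchySeq (ε / (4 * (|t| + 1))) (by positivity)
  refine ⟨N, fun n hn => ?_⟩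
  have h1 := hN n hn
  rw [dist_eq_norm] at h1 hxd ⊢
  have h2 := norm_exp_sub_exp_le (P.A_skew N) (P.A_skew n) (P.commute_A N n) t d
  have h3 : ‖P.A n d - P.A N d‖ * |t| ≤ ε / (4 * (|t| + 1)) * (|t| + 1) := by
    gcongr
    linarith
  have h4 : ε / (4 * (|t| + 1)) * (|t| + 1) = ε / 4 := by field_simp
  have h5 : NormedSpace.exp (t • P.A n) x - NormedSpace.exp (t • P.A N) x =
      NormedSpace.exp (t • P.A n) (x - d) - NormedSpace.exp (t • P.A N) (x - d) +
      (NormedSpace.exp (t • P.A n) d - NormedSpace.exp (t • P.A N) d) := by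
    rw [map_sub, map_sub]; abel
  have h6 := norm_add_le (NormedSpace.exp (t • P.A n) (x - d) - NormedSpace.exp (t • P.A N) (x - d))
      (NormedSpace.exp (t • P.A n) d - NormedSpace.exp (t • P.A N) d)
  have h7 := norm_sub_le (NormedSpace.exp (t • P.A n) (x - d)) (NormedSpace.exp (t • P.A N) (x - d))
  rw [(P.A_skew n).norm_exp_apply, (P.A_skew N).norm_exp_apply] at h7
  rw [h5]
  linarith

/-- The group generated by the weak operator, as the strong limit of the groups generated by its
regularizations. -/
noncomputable def U (t : ℝ) (x : H) : H := limUnder atTop (fun n => NormedSpace.exp (t • P.A n) x)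

theorem tendsto_U (t : ℝ) (x : H) :
    Tendsto (fun n => NormedSpace.exp (t • P.A n) x) atTop (𝓝 (P.U t x)) :=
  CauchySeq.tendsto_limUnder (P.cauchySeq_exp t x)

@[simp]
theorem norm_U (t : ℝ) (x : H) : ‖P.U t x‖ = ‖x‖ :=
  tendsto_nhds_unique (P.tendsto_U t x).norm
    (by simp only [(P.A_skew _).norm_exp_apply]; exact tendsto_const_nhds)

theorem U_add (t : ℝ) (x y : H) : P.U t (x + y) = P.U t x + P.U t y :=
  tendsto_nhds_unique (P.tendsto_U t (x + y))
    (by simpa only [map_add] using (P.tendsto_U t x).add (P.tendsto_U t y))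

theorem U_smul (t c : ℝ) (x : H) : P.U t (c • x) = c • P.U t x :=
  tendsto_nhds_unique (P.tendsto_U t (c • x))
    (by simpa only [map_smul] using (P.tendsto_U t x).const_smul c)

/-- The evolution operator as a linear isometry. -/
noncomputable def Uₗᵢ (t : ℝ) : H →ₗᵢ[ℝ] H where
  toFun := P.U t
  map_add' := P.U_add t
  map_smul' := P.U_smul t
  norm_map' := P.norm_U t

theorem U_sub (t : ℝ) (x y : H) : P.U t (x - y) = P.U t x - P.U t y := (P.Uₗᵢ t).map_sub x y

theorem inner_U (t : ℝ) (x y : H) : inner ℝ (P.U t x) (P.U t y) = inner ℝ x y :=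
  (P.Uₗᵢ t).inner_map_map x y

theorem tendsto_exp_of_tendsto (t : ℝ) {z : ℕ → H} {x : H} (hz : Tendsto z atTop (𝓝 x)) :
    Tendsto (fun n => NormedSpace.exp (t • P.A n) (z n)) atTop (𝓝 (P.U t x)) := by
  have h : Tendsto (fun n => NormedSpace.exp (t • P.A n) (z n - x)) atTop (𝓝 0) := by
    rw [tendsto_zero_iff_norm_tendsto_zero]
    simp only [(P.A_skew _).norm_exp_apply]
    exact (tendsto_iff_norm_sub_tendsto_zero.1 hz)
  simpa [map_sub] using h.add (P.tendsto_U t x)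

@[simp]
theorem U_zero (x : H) : P.U 0 x = x :=
  tendsto_nhds_unique (P.tendsto_U 0 x)
    (by simp only [zero_smul, NormedSpace.exp_zero, one_apply_eq_self]
        exact tendsto_const_nhds)

theorem U_add_time (s t : ℝ) (x : H) : P.U (s + t) x = P.U s (P.U t x) :=
  tendsto_nhds_unique (P.tendsto_U (s + t) x)
    (by simpa only [exp_add_apply] using P.tendsto_exp_of_tendsto s (P.tendsto_U t x))

@[simp]
theorem U_neg_U (t : ℝ) (x : H) : P.U (-t) (P.U t x) = x := by
  rw [← U_add_time, neg_add_cancel, U_zero]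

theorem inner_U_right (t : ℝ) (x y : H) : inner ℝ x (P.U t y) = inner ℝ (P.U (-t) x) y := by
  rw [← P.inner_U (-t) x, U_neg_U]

theorem continuous_U_time (x : H) : Continuous fun t => P.U t x := by
  rw [Metric.continuous_iff]
  intro s ε hε
  obtain ⟨d, ⟨y, hy⟩, hxd⟩ := P.dense_domain.exists_dist_lt x (show 0 < ε / 4 by positivity)
  refine ⟨ε / (4 * (‖y‖ + 1)), by positivity, fun t ht => ?_⟩
  have h1 : ‖P.U t d - P.U s d‖ ≤ ‖y‖ * |t - s| :=
    le_of_tendsto_of_tendsto ((P.tendsto_U t d).sub (P.tendsto_U s d)).norm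
      (hy.norm.mul_const _)
      (Eventually.of_forall fun n => (P.A_skew n).norm_exp_sub_exp_time_le s t d)
  rw [dist_eq_norm] at hxd ht ⊢
  rw [Real.norm_eq_abs] at ht
  have h2 : ‖y‖ * |t - s| ≤ (‖y‖ + 1) * (ε / (4 * (‖y‖ + 1))) := by
    gcongr
    linarith
  have h3 : (‖y‖ + 1) * (ε / (4 * (‖y‖ + 1))) = ε / 4 := by field_simp
  have h4 : P.U t x - P.U s x = (P.U t (x - d) - P.U s (x - d)) + (P.U t d - P.U s d) := by
    rw [U_sub, U_sub]; abel
  have h5 := norm_add_le (P.U t (x - d) - P.U s (x - d)) (P.U t d - P.U s d)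
  have h6 := norm_sub_le (P.U t (x - d)) (P.U s (x - d))
  rw [norm_U, norm_U] at h6
  rw [h4]
  linarith

theorem continuous_U : Continuous fun z : ℝ × H => P.U z.1 z.2 := by
  rw [continuous_iff_continuousAt]
  rintro ⟨s, x⟩
  have h1 : Tendsto (fun z : ℝ × H => P.U z.1 (z.2 - x)) (𝓝 (s, x)) (𝓝 0) := by
    rw [tendsto_zero_iff_norm_tendsto_zero]
    simp only [norm_U]
    have : Continuous fun z : ℝ × H => ‖z.2 - x‖ := by fun_prop
    simpa using this.tendsto (s, x)
  have h2 : Tendsto (fun z : ℝ × H => P.U z.1 x) (𝓝 (s, x)) (𝓝 (P.U s x)) :=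
    ((P.continuous_U_time x).comp continuous_fst).tendsto (s, x)
  simpa [ContinuousAt, U_sub] using h1.add h2

theorem continuous_U_comp {X : Type*} [TopologicalSpace X] {r : X → ℝ} {f : X → H}
    (hr : Continuous r) (hf : Continuous f) : Continuous fun z => P.U (r z) (f z) :=
  Continuous.comp (g := fun z : ℝ × H => P.U z.1 z.2) (f := fun z => (r z, f z)) P.continuous_U
    (hr.prodMk hf)

theorem hasDerivAt_U_e (i : ι) (t : ℝ) :
    HasDerivAt (fun s => P.U s (P.e i)) (P.U t (P.a i)) t := by
  have hint : ∀ t, P.U t (P.e i) = P.e i + ∫ s in (0 : ℝ)..t, P.U s (P.a i) := by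
    intro t
    obtain ⟨C, hC⟩ := (P.tendsto_A_e i).norm.bddAbove_range
    have h1 : Tendsto (fun n => ∫ s in (0 : ℝ)..t, NormedSpace.exp (s • P.A n) (P.A n (P.e i)))
        atTop (𝓝 (∫ s in (0 : ℝ)..t, P.U s (P.a i))) := by
      refine intervalIntegral.tendsto_integral_filter_of_dominated_convergence (fun _ => C)
        ?_ ?_ ?_ ?_
      · refine Eventually.of_forall fun n => Continuous.aestronglyMeasurable ?_
        exact continuous_iff_continuousAt.2
          fun s => (hasDerivAt_exp_apply (P.A n) _ s).continuousAt
      · refine Eventually.of_forall fun n => Eventually.of_forall fun s _ => ?_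
        rw [(P.A_skew n).norm_exp_apply]
        exact hC ⟨n, rfl⟩
      · exact intervalIntegrable_const
      · exact Eventually.of_forall fun s _ => P.tendsto_exp_of_tendsto s (P.tendsto_A_e i)
    have h2 : ∀ n, NormedSpace.exp (t • P.A n) (P.e i) =
        P.e i + ∫ s in (0 : ℝ)..t, NormedSpace.exp (s • P.A n) (P.A n (P.e i)) := by
      intro n
      have hc : Continuous fun s : ℝ => NormedSpace.exp (s • P.A n) (P.A n (P.e i)) :=
        continuous_iff_continuousAt.2 fun s => (hasDerivAt_exp_apply (P.A n) _ s).continuousAt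
      rw [intervalIntegral.integral_eq_sub_of_hasDerivAt
        (fun s _ => hasDerivAt_exp_apply' (P.A n) (P.e i) s) (hc.intervalIntegrable _ _)]
      simp
    refine tendsto_nhds_unique (P.tendsto_U t (P.e i)) ?_
    simp only [h2]
    exact h1.const_add _
  have hfun : (fun s => P.U s (P.e i)) =
      fun t => P.e i + ∫ s in (0 : ℝ)..t, P.U s (P.a i) := funext hint
  rw [hfun]
  exact ((P.continuous_U_time (P.a i)).integral_hasStrictDerivAt 0 t).hasDerivAt.const_add _

/-- In the interaction picture `F(t) = U(t) G(t)` the equation `G' = U(-t) J` becomes the weak form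
of the evolution equation with source `J`. -/
theorem hasDerivAt_inner_U {G : ℝ → H} {J : H} {t : ℝ} (hG : HasDerivAt G (P.U (-t) J) t)
    (i : ι) :
    HasDerivAt (fun s => inner ℝ (P.e i) (P.U s (G s)))
      (-inner ℝ (P.a i) (P.U t (G t)) + inner ℝ (P.e i) J) t := by
  have h1 : HasDerivAt (fun s => P.U (-s) (P.e i)) (-P.U (-t) (P.a i)) t := by
    have h := (P.hasDerivAt_U_e i (-t)).scomp t (hasDerivAt_neg t)
    simpa [Function.comp_def] using h
  have h2 := h1.inner ℝ hG
  simp only [P.inner_U_right]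
  rw [P.inner_U, inner_neg_left, add_comm] at h2
  exact h2

theorem eq_zero_of_weak {F : ℝ → H} (hF : Continuous F)
    (h : ∀ t i, inner ℝ (P.e i) (F t) = ∫ s in (0 : ℝ)..t, -inner ℝ (P.a i) (F s)) (t : ℝ) :
    F t = 0 := by
  -- The time integral of `F` lies in the domain of the weak operator, with image `F`; so the
  -- regularized solution is differentiable in norm and the energy method applies to it.
  have hS : ∀ n t, P.S n (F t) = P.A n (∫ s in (0 : ℝ)..t, F s) := by
    intro n t
    apply P.S_eq_A
    intro i
    have h1 := (innerSL ℝ (P.a i)).intervalIntegral_comp_comm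
      (hF.intervalIntegrable (μ := volume) 0 t)
    simp only [innerSL_apply_apply] at h1
    rw [h, intervalIntegral.integral_neg, h1]
  have hd : ∀ n t, HasDerivAt (fun t => P.S n (F t)) (P.A n (F t)) t := by
    intro n t
    simp only [hS]
    exact (P.A n).hasFDerivAt.comp_hasDerivAt t (hF.integral_hasStrictDerivAt 0 t).hasDerivAt
  have hz : ∀ n t, P.S n (F t) = 0 := by
    intro n t
    have hd2 : ∀ t, HasDerivAt (fun t => ‖P.S n (F t)‖ ^ 2) 0 t := by
      intro t
      have h1 := (hd n t).norm_sq
      have h2 : inner ℝ (P.S n (F t)) (P.A n (F t)) = 0 := by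
        have h3 : inner ℝ (P.S n (F t)) (P.A n (F t)) =
            -inner ℝ (P.S n (F t)) (P.A n (F t)) := by
          conv_lhs => rw [real_inner_comm, P.A_skew, P.A_S, ← P.S_symm]
        linarith
      rw [h2, mul_zero] at h1
      exact h1
    have h1 := is_const_of_deriv_eq_zero (fun s => (hd2 s).differentiableAt)
      (fun s => (hd2 s).deriv) t 0
    rw [hS n 0, intervalIntegral.integral_same, map_zero, norm_zero] at h1
    simpa using h1
  refine tendsto_nhds_unique (P.S_tendsto (F t)) ?_
  simp only [hz]
  exact tendsto_const_nhds

theorem weak_unique {F V J : ℝ → H} (hF : Continuous F) (hV : Continuous V) (hJ : Continuous J)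
    {x : H} (hFw : ∀ t i, inner ℝ (P.e i) (F t) = inner ℝ (P.e i) x +
      ∫ s in (0 : ℝ)..t, (-inner ℝ (P.a i) (F s) + inner ℝ (P.e i) (J s)))
    (hVw : ∀ t i, inner ℝ (P.e i) (V t) = inner ℝ (P.e i) x +
      ∫ s in (0 : ℝ)..t, (-inner ℝ (P.a i) (V s) + inner ℝ (P.e i) (J s))) : F = V := by
  have hint : ∀ {W : ℝ → H}, Continuous W → ∀ t i, IntervalIntegrable
      (fun s => -inner ℝ (P.a i) (W s) + inner ℝ (P.e i) (J s)) volume 0 t := fun hW t i =>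
    (((continuous_const.inner hW).neg).add (continuous_const.inner hJ)).intervalIntegrable _ _
  have h : ∀ t i, inner ℝ (P.e i) (F t - V t) =
      ∫ s in (0 : ℝ)..t, -inner ℝ (P.a i) (F s - V s) := by
    intro t i
    rw [inner_sub_right, hFw, hVw, add_sub_add_left_eq_sub,
      ← intervalIntegral.integral_sub (hint hF t i) (hint hV t i)]
    congr 1
    ext s
    rw [inner_sub_right]
    ring
  funext t
  exact sub_eq_zero.1 (P.eq_zero_of_weak (F := fun t => F t - V t) (hF.sub hV) h t)

/-- Weak solutions with a continuous source are given by Duhamel's formula. -/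
theorem eq_duhamel_of_weak {F J : ℝ → H} (hF : Continuous F) (hJ : Continuous J) {x : H}
    (h : ∀ t i, inner ℝ (P.e i) (F t) = inner ℝ (P.e i) x +
      ∫ s in (0 : ℝ)..t, (-inner ℝ (P.a i) (F s) + inner ℝ (P.e i) (J s))) (t : ℝ) :
    F t = P.U t (x + ∫ s in (0 : ℝ)..t, P.U (-s) (J s)) := by
  have hcJ : Continuous fun s => P.U (-s) (J s) :=
    P.continuous_U_comp continuous_neg hJ
  obtain ⟨G, hG⟩ : ∃ G : ℝ → H, ∀ t, G t = x + ∫ s in (0 : ℝ)..t, P.U (-s) (J s) :=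
    ⟨_, fun _ => rfl⟩
  have hGd : ∀ t, HasDerivAt G (P.U (-t) (J t)) t := by
    intro t
    rw [funext hG]
    exact (hcJ.integral_hasStrictDerivAt 0 t).hasDerivAt.const_add x
  have hGc : Continuous G := continuous_iff_continuousAt.2 fun t => (hGd t).continuousAt
  have hUG : Continuous fun t => P.U t (G t) := P.continuous_U_comp continuous_id hGc
  have hw : ∀ t i, inner ℝ (P.e i) (P.U t (G t)) = inner ℝ (P.e i) x +
      ∫ s in (0 : ℝ)..t, (-inner ℝ (P.a i) (P.U s (G s)) + inner ℝ (P.e i) (J s)) := by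
    intro t i
    have hd := fun s => P.hasDerivAt_inner_U (hGd s) i
    have hc : Continuous fun s => -inner ℝ (P.a i) (P.U s (G s)) + inner ℝ (P.e i) (J s) :=
      ((continuous_const.inner hUG).neg).add (continuous_const.inner hJ)
    rw [intervalIntegral.integral_eq_sub_of_hasDerivAt (fun s _ => hd s)
      (hc.intervalIntegrable _ _)]
    simp [hG]
  rw [← hG]
  exact congrFun (P.weak_unique hF hUG hJ h hw) t

end SkewApprox

end SkewEvolution

/-! ### Global solutions of ordinary differential equations in Banach spaces -/

namespace GlobalODE

open Filter Topology Set
open scoped NNReal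

section Uniqueness

variable {X : Type*} [NormedAddCommGroup X] [NormedSpace ℝ X] {f : ℝ → X → X}

/-- Uniqueness for an equation whose right-hand side is Lipschitz on bounded sets. -/
theorem eqOn_Ioo (hlip : ∀ r : ℝ, ∃ K : ℝ≥0, ∀ t, LipschitzOnWith K (f t) (Metric.closedBall 0 r))
    {x y : ℝ → X} {a : ℝ} (hx : ∀ t ∈ Ioo (-a) a, HasDerivAt x (f t (x t)) t)
    (hy : ∀ t ∈ Ioo (-a) a, HasDerivAt y (f t (y t)) t) (h0 : x 0 = y 0) :
    EqOn x y (Ioo (-a) a) := by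
  intro s hs
  obtain ⟨b, hb1, hb2⟩ := exists_between (abs_lt.2 hs)
  have hbpos : 0 < b := (abs_nonneg s).trans_lt hb1
  have hsub : Icc (-b) b ⊆ Ioo (-a) a := fun u hu => ⟨by linarith [hu.1], by linarith [hu.2]⟩
  have hxc : ContinuousOn x (Icc (-b) b) := fun u hu =>
    (hx u (hsub hu)).continuousAt.continuousWithinAt
  have hyc : ContinuousOn y (Icc (-b) b) := fun u hu =>
    (hy u (hsub hu)).continuousAt.continuousWithinAt
  obtain ⟨Cx, hCx⟩ := isCompact_Icc.exists_bound_of_continuousOn hxc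
  obtain ⟨Cy, hCy⟩ := isCompact_Icc.exists_bound_of_continuousOn hyc
  obtain ⟨K, hK⟩ := hlip (max Cx Cy)
  refine ODE_solution_unique_of_mem_Icc (v := f) (K := K) (t₀ := 0) (a := -b) (b := b)
    (s := fun _ => Metric.closedBall 0 (max Cx Cy)) (fun t _ => hK t)
    ⟨by linarith, hbpos⟩ hxc (fun t ht => hx t (hsub (Ioo_subset_Icc_self ht))) ?_ hyc
    (fun t ht => hy t (hsub (Ioo_subset_Icc_self ht))) ?_ h0 (abs_le.1 hb1.le)
  · intro t ht
    simpa using Or.inl (hCx t (Ioo_subset_Icc_self ht))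
  · intro t ht
    simpa using Or.inr (hCy t (Ioo_subset_Icc_self ht))

theorem unique (hlip : ∀ r : ℝ, ∃ K : ℝ≥0, ∀ t, LipschitzOnWith K (f t) (Metric.closedBall 0 r))
    {x y : ℝ → X} (hx : ∀ t, HasDerivAt x (f t (x t)) t)
    (hy : ∀ t, HasDerivAt y (f t (y t)) t) (h0 : x 0 = y 0) : x = y := by
  funext t
  exact eqOn_Ioo hlip (a := |t| + 1) (fun t _ => hx t) (fun t _ => hy t) h0
    (abs_lt.1 (lt_add_one |t|))

/-- Solutions on all symmetric intervals can be glued to a global solution. -/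
theorem exists_global_of_exists_Ioo
    (hlip : ∀ r : ℝ, ∃ K : ℝ≥0, ∀ t, LipschitzOnWith K (f t) (Metric.closedBall 0 r)) {x₀ : X}
    (h : ∀ a > 0, ∃ x : ℝ → X, x 0 = x₀ ∧ ∀ t ∈ Ioo (-a) a, HasDerivAt x (f t (x t)) t) :
    ∃ x : ℝ → X, x 0 = x₀ ∧ ∀ t, HasDerivAt x (f t (x t)) t := by
  have h' : ∀ n : ℕ, ∃ x : ℝ → X, x 0 = x₀ ∧
      ∀ t ∈ Ioo (-(n + 1 : ℝ)) (n + 1), HasDerivAt x (f t (x t)) t :=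
    fun n => h (n + 1) (by positivity)
  choose x hx0 hx using h'
  have hmem : ∀ t : ℝ, t ∈ Ioo (-((⌈|t|⌉₊ : ℝ) + 1)) (⌈|t|⌉₊ + 1) := fun t =>
    abs_lt.1 ((Nat.le_ceil |t|).trans_lt (lt_add_one _))
  have hagree : ∀ n m : ℕ, n ≤ m → EqOn (x n) (x m) (Ioo (-(n + 1 : ℝ)) (n + 1)) := by
    intro n m hnm
    have hnm' : (n : ℝ) ≤ m := by exact_mod_cast hnm
    refine eqOn_Ioo hlip (hx n) (fun t ht => hx m t ⟨?_, ?_⟩) ((hx0 n).trans (hx0 m).symm)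
    · linarith [ht.1]
    · linarith [ht.2]
  refine ⟨fun t => x ⌈|t|⌉₊ t, by simp [hx0], fun t => ?_⟩
  refine (hx _ t (hmem t)).congr_of_eventuallyEq ?_
  filter_upwards [isOpen_Ioo.mem_nhds (hmem t)] with s hs
  rcases le_total ⌈|s|⌉₊ ⌈|t|⌉₊ with hle | hle
  · exact hagree _ _ hle (hmem s)
  · exact (hagree _ _ hle hs).symm

end Uniqueness

variable {X₁ X₂ : Type*} [NormedAddCommGroup X₁] [NormedSpace ℝ X₁] [CompleteSpace X₁]
  [NormedAddCommGroup X₂] [NormedSpace ℝ X₂] [CompleteSpace X₂]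

/-- Global existence when the first component of the vector field is bounded and the second one
grows at most linearly in the first variable. In the variables `(x₁, x₂ / l)` with `l` large both
components obey the same bound on a ball of radius `c T`, so that a single application of the
Picard-Lindelöf theorem covers all of `[-T, T]`. -/
theorem exists_global {f : ℝ → X₁ × X₂ → X₁ × X₂} (hcont : ∀ x, Continuous fun t => f t x)
    (hlip : ∀ r : ℝ, ∃ K : ℝ≥0, ∀ t, LipschitzOnWith K (f t) (Metric.closedBall 0 r)) {c : ℝ}
    (h1 : ∀ t x, ‖(f t x).1‖ ≤ c) (h2 : ∀ t x, ‖(f t x).2‖ ≤ c * (1 + ‖x.1‖)) (x₀ : X₁ × X₂) :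
    ∃ x : ℝ → X₁ × X₂, x 0 = x₀ ∧ ∀ t, HasDerivAt x (f t (x t)) t := by
  refine exists_global_of_exists_Ioo hlip fun T hT => ?_
  have hc : 0 ≤ c := (norm_nonneg _).trans (h1 0 x₀)
  set l : ℝ := 1 + ‖x₀.1‖ + c * T with hl
  have hlpos : 0 < l := by positivity
  let D : X₁ × X₂ →L[ℝ] X₁ × X₂ :=
    (ContinuousLinearMap.fst ℝ X₁ X₂).prod (l • ContinuousLinearMap.snd ℝ X₁ X₂)
  let D' : X₁ × X₂ →L[ℝ] X₁ × X₂ :=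
    (ContinuousLinearMap.fst ℝ X₁ X₂).prod (l⁻¹ • ContinuousLinearMap.snd ℝ X₁ X₂)
  have hDD' : ∀ x, D (D' x) = x := by
    intro x
    simp [D, D', smul_smul, hlpos.ne']
  obtain ⟨K, hK⟩ := hlip (‖D‖ * (‖D' x₀‖ + c * T))
  have hball : ∀ y ∈ Metric.closedBall (D' x₀) (c * T),
      D y ∈ Metric.closedBall 0 (‖D‖ * (‖D' x₀‖ + c * T)) := by
    intro y hy
    rw [mem_closedBall_iff_norm] at hy
    rw [mem_closedBall_zero_iff]
    refine (D.le_opNorm y).trans ?_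
    gcongr
    have := norm_le_norm_add_norm_sub' y (D' x₀)
    linarith
  have hPL : IsPicardLindelof (fun t y => D' (f t (D y))) (tmin := -T) (tmax := T)
      ⟨0, by constructor <;> linarith⟩ (D' x₀) ⟨c * T, by positivity⟩ 0 ⟨c, hc⟩
      (‖D'‖₊ * (K * ‖D‖₊)) := by
    refine ⟨fun t _ => ?_, fun y _ => ?_, fun t _ y hy => ?_, ?_⟩
    · exact D'.lipschitz.comp_lipschitzOnWith
        ((hK t).comp (D.lipschitz.lipschitzOnWith) hball)
    · exact (D'.continuous.comp (hcont (D y))).continuousOn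
    · have hy1 : ‖y.1‖ ≤ ‖x₀.1‖ + c * T := by
        rw [mem_closedBall_iff_norm] at hy
        have h3 : ‖(y - D' x₀).1‖ ≤ c * T := (norm_fst_le _).trans hy
        have h4 : (y - D' x₀).1 = y.1 - x₀.1 := by simp [D']
        rw [h4] at h3
        have := norm_le_norm_add_norm_sub' y.1 x₀.1
        linarith
      have hf2 : ‖l⁻¹ • (f t (D y)).2‖ ≤ c := by
        rw [norm_smul, norm_inv, Real.norm_of_nonneg hlpos.le, inv_mul_le_iff₀ hlpos, mul_comm l]
        refine (h2 t (D y)).trans ?_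
        have h5 : (D y).1 = y.1 := by simp [D]
        refine mul_le_mul_of_nonneg_left ?_ hc
        rw [h5, hl]
        linarith
      change ‖((f t (D y)).1, l⁻¹ • (f t (D y)).2)‖ ≤ c
      exact max_le (h1 t (D y)) hf2
    · simp only [sub_zero, zero_sub, neg_neg, max_self, NNReal.coe_zero]
      exact le_rfl
  obtain ⟨y, hy0, hy⟩ := hPL.exists_eq_forall_mem_Icc_hasDerivWithinAt₀
  refine ⟨fun t => D (y t), ?_, fun t ht => ?_⟩
  · change D (y 0) = x₀
    rw [show y 0 = D' x₀ from hy0, hDD']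
  · have h3 := (hy t (Ioo_subset_Icc_self ht)).hasDerivAt (Icc_mem_nhds ht.1 ht.2)
    have h4 := D.hasFDerivAt.comp_hasDerivAt t h3
    rw [hDD'] at h4
    exact h4

end GlobalODE

namespace AbrahamModel

open Filter Topology SkewEvolution
open scoped Convolution

/-! ### The vector product and the curl -/

/-- The vector product as a continuous bilinear map. -/
noncomputable def crossB : E3 →L[ℝ] E3 →L[ℝ] E3 :=
  LinearMap.toContinuousBilinearMap (LinearMap.mk₂ ℝ cross
    (by intros; simp [cross]) (by intros; simp [cross])
    (by intros; simp [cross]) (by intros; simp [cross]))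

theorem crossB_apply (a b : E3) : crossB a b = cross a b := rfl

theorem inner_crossB_left (a b c : E3) : inner ℝ (crossB a b) c = -inner ℝ b (crossB a c) := by
  simp [crossB_apply, cross, crossProduct, PiLp.inner_apply, Fin.sum_univ_three]
  ring

theorem inner_crossB_self (a b : E3) : inner ℝ a (crossB a b) = 0 := by
  simp [crossB_apply, cross, crossProduct, PiLp.inner_apply, Fin.sum_univ_three]
  ring

/-- The `i`-th standard basis vector. -/
noncomputable abbrev basisVec (i : Fin 3) : E3 := EuclideanSpace.single i 1

theorem curl_eq_sum (F : E3 → E3) (x : E3) :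
    curl F x = ∑ i : Fin 3, crossB (basisVec i) (fderiv ℝ F x (basisVec i)) := by
  ext j
  fin_cases j <;>
    simp [curl, partialD, Fin.sum_univ_three, crossB_apply, cross, crossProduct] <;> ring

theorem IsTest.fderiv_apply {V : Type*} [NormedAddCommGroup V] [NormedSpace ℝ V] {f : E3 → V}
    (hf : IsTest f) (v : E3) : IsTest fun x => fderiv ℝ f x v :=
  ⟨(hf.1.fderiv_right (m := ∞) (by simp)).clm_apply contDiff_const, hf.2.fderiv_apply ℝ v⟩

theorem IsTest.clm_comp {V W : Type*} [NormedAddCommGroup V] [NormedSpace ℝ V]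
    [NormedAddCommGroup W] [NormedSpace ℝ W] {f : E3 → V} (hf : IsTest f) (L : V →L[ℝ] W) :
    IsTest fun x => L (f x) :=
  ⟨L.contDiff.comp hf.1, hf.2.comp_left (g := L) (map_zero L)⟩

theorem IsTest.curl {ψ : E3 → E3} (hψ : IsTest ψ) : IsTest (curl ψ) := by
  have h : AbrahamModel.curl ψ = fun x => crossB (basisVec 0) (fderiv ℝ ψ x (basisVec 0)) +
      crossB (basisVec 1) (fderiv ℝ ψ x (basisVec 1)) +
      crossB (basisVec 2) (fderiv ℝ ψ x (basisVec 2)) := by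
    funext x
    rw [curl_eq_sum, Fin.sum_univ_three]
  have hi := fun i : Fin 3 => (hψ.fderiv_apply (basisVec i)).clm_comp (crossB (basisVec i))
  rw [h]
  exact ⟨((hi 0).1.add (hi 1).1).add (hi 2).1, ((hi 0).2.add (hi 1).2).add (hi 2).2⟩

theorem IsTest.comp_add_right {V : Type*} [NormedAddCommGroup V] [NormedSpace ℝ V] {f : E3 → V}
    (hf : IsTest f) (y : E3) : IsTest fun x => f (x + y) :=
  ⟨hf.1.comp (contDiff_id.add contDiff_const), hf.2.comp_homeomorph (Homeomorph.addRight y)⟩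

theorem curl_comp_add_right (F : E3 → E3) (y : E3) :
    curl (fun x => F (x + y)) = fun x => curl F (x + y) := by
  funext x
  simp only [curl_eq_sum, fderiv_comp_add_right]

/-! ### Square integrable fields and translations -/

theorem IsTest.memLp {V : Type*} [NormedAddCommGroup V] [NormedSpace ℝ V] {f : E3 → V}
    (hf : IsTest f) : MemLp f 2 (volume : Measure E3) :=
  hf.1.continuous.memLp_of_hasCompactSupport hf.2

/-- The class of a test field in `L²`. -/
noncomputable def IsTest.toL2 {ψ : E3 → E3} (hψ : IsTest ψ) : L2Field := hψ.memLp.toLp ψ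

theorem pairing_congr {F G F' G' : E3 → E3} (hF : F =ᵐ[volume] F') (hG : G =ᵐ[volume] G') :
    pairing F G = pairing F' G' := by
  refine integral_congr_ae ?_
  filter_upwards [hF, hG] with x h1 h2
  rw [h1, h2]

theorem inner_eq_pairing (F G : L2Field) : inner ℝ F G = pairing F G := rfl

theorem IsTest.inner_toL2 {ψ : E3 → E3} (hψ : IsTest ψ) (F : L2Field) :
    inner ℝ hψ.toL2 F = pairing ψ F :=
  pairing_congr hψ.memLp.coeFn_toLp (ae_eq_refl _)

/-- Translation `(τ_y F)(x) = F(x - y)` of fields. -/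
noncomputable def translate (y : E3) : L2Field →ₗᵢ[ℝ] L2Field :=
  Lp.compMeasurePreservingₗᵢ ℝ (fun x => x - y) (measurePreserving_sub_right volume y)

theorem translate_ae (y : E3) (F : L2Field) : translate y F =ᵐ[volume] fun x => F (x - y) :=
  Lp.coeFn_compMeasurePreserving F (measurePreserving_sub_right volume y)

theorem continuous_translate (F : L2Field) : Continuous fun y => translate y F := by
  have hg : Continuous fun y : E3 => (ContinuousMap.mk (fun x : E3 => x - y) (by fun_prop)) :=
    ContinuousMap.continuous_of_continuous_uncurry _
      (by change Continuous fun p : E3 × E3 => p.2 - p.1; fun_prop)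
  exact (continuous_const (y := F)).compMeasurePreservingLp hg
    (fun y => measurePreserving_sub_right volume y) (by simp)

theorem translate_translate (y z : E3) (F : L2Field) :
    translate y (translate z F) = translate (y + z) F := by
  apply Lp.ext
  have h1 := (measurePreserving_sub_right (volume : Measure E3) y).quasiMeasurePreserving.ae
    (translate_ae z F)
  filter_upwards [translate_ae y (translate z F), translate_ae (y + z) F, h1] with x h2 h3 h4
  rw [h2, h3, h4, sub_sub]

theorem translate_zero (F : L2Field) : translate 0 F = F := by
  apply Lp.ext
  filter_upwards [translate_ae 0 F] with x h
  rw [h, sub_zero]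

theorem inner_translate_left (y : E3) (F G : L2Field) :
    inner ℝ (translate y F) G = inner ℝ F (translate (-y) G) := by
  rw [← (translate y).inner_map_map F, translate_translate, add_neg_cancel, translate_zero]

theorem IsTest.translate_toL2 {ψ : E3 → E3} (hψ : IsTest ψ) (y : E3) :
    translate (-y) hψ.toL2 = (hψ.comp_add_right y).toL2 := by
  apply Lp.ext
  have h1 := (measurePreserving_sub_right (volume : Measure E3) (-y)).quasiMeasurePreserving.ae
    hψ.memLp.coeFn_toLp
  filter_upwards [translate_ae (-y) hψ.toL2, (hψ.comp_add_right y).memLp.coeFn_toLp, h1]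
    with x h2 h3 h4
  rw [sub_neg_eq_add] at h4
  rw [h2, sub_neg_eq_add]
  exact h4.trans h3.symm

theorem eq_zero_of_inner_toL2 {F : L2Field}
    (h : ∀ ψ : E3 → E3, ∀ hψ : IsTest ψ, inner ℝ hψ.toL2 F = 0) : F = 0 := by
  have hF : LocallyIntegrable F (volume : Measure E3) :=
    (Lp.memLp F).locallyIntegrable (by norm_num)
  apply Lp.ext
  have h0 := ae_eq_zero_of_integral_contDiff_smul_eq_zero hF (fun g hg hgc => by
    refine ext_inner_left ℝ fun w => ?_
    rw [← integral_inner (hF.integrable_smul_left_of_hasCompactSupport hg.continuous hgc),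
      inner_zero_right]
    have hψ : IsTest fun x => g x • w := ⟨hg.smul contDiff_const, hgc.smul_right⟩
    rw [← h _ hψ, hψ.inner_toL2]
    refine integral_congr_ae (Eventually.of_forall fun x => ?_)
    simp only [inner_smul_left, inner_smul_right, RCLike.conj_to_real])
  filter_upwards [h0, Lp.coeFn_zero E3 2 (volume : Measure E3)] with x h1 h2
  rw [h1, h2]
  rfl

/-! ### Mollification -/

/-- A continuous weight with compact support, used to average translates. -/
structure Weight where
  toFun : E3 → ℝ
  cont : Continuous toFun
  supp : HasCompactSupport toFun

namespace Weight

theorem integrable_smul_translate (η : Weight) (F : L2Field) :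
    Integrable fun y => η.toFun y • translate y F :=
  (η.cont.smul (continuous_translate F)).integrable_of_hasCompactSupport η.supp.smul_right

/-- The convolution `η ∗ F = ∫ η(y) τ_y F dy`, as a bounded operator on `L²`. -/
noncomputable def avg (η : Weight) : L2Field →L[ℝ] L2Field :=
  LinearMap.mkContinuous
    { toFun := fun F => ∫ y, η.toFun y • translate y F
      map_add' := fun F G => by
        simp only [map_add, smul_add]
        exact integral_add (η.integrable_smul_translate F) (η.integrable_smul_translate G)
      map_smul' := fun c F => by
        simp only [map_smul, smul_comm _ c, integral_smul, RingHom.id_apply] }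
    (∫ y, ‖η.toFun y‖)
    (fun F => by
      refine (norm_integral_le_integral_norm _).trans (le_of_eq ?_)
      simp only [norm_smul, LinearIsometry.norm_map, integral_mul_const])

theorem avg_apply (η : Weight) (F : L2Field) : η.avg F = ∫ y, η.toFun y • translate y F := rfl

theorem inner_avg (η : Weight) (F G : L2Field) :
    inner ℝ F (η.avg G) = ∫ y, η.toFun y * inner ℝ F (translate y G) := by
  rw [avg_apply, ← integral_inner (η.integrable_smul_translate G)]
  simp only [inner_smul_right]

theorem inner_avg_left (η : Weight) (F G : L2Field) :
    inner ℝ (η.avg F) G = ∫ y, η.toFun (-y) * inner ℝ F (translate y G) := by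
  rw [real_inner_comm, inner_avg, ← integral_neg_eq_self]
  congr 1
  ext y
  rw [real_inner_comm, inner_translate_left, neg_neg]

/-- Convolutions commute with every bounded operator that commutes with translations. -/
theorem avg_comm (η : Weight) (L : L2Field →L[ℝ] L2Field)
    (hL : ∀ y F, L (translate y F) = translate y (L F)) (F : L2Field) :
    L (η.avg F) = η.avg (L F) := by
  rw [avg_apply, avg_apply, ← L.integral_comp_comm (η.integrable_smul_translate F)]
  simp only [map_smul, hL]

theorem avg_translate (η : Weight) (z : E3) (F : L2Field) :
    η.avg (translate z F) = translate z (η.avg F) := by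
  have h := η.avg_comm (translate z).toContinuousLinearMap (fun y G => by
    simp only [LinearIsometry.coe_toContinuousLinearMap, translate_translate, add_comm]) F
  exact h.symm

end Weight

/-- The operator `F ↦ a × F` on fields. -/
noncomputable def crossL2 (a : E3) : L2Field →L[ℝ] L2Field := (crossB a).compLpL 2 volume

theorem crossL2_ae (a : E3) (F : L2Field) : crossL2 a F =ᵐ[volume] fun x => crossB a (F x) :=
  (crossB a).coeFn_compLpL F

theorem inner_crossL2_left (a : E3) (F G : L2Field) :
    inner ℝ (crossL2 a F) G = -inner ℝ F (crossL2 a G) := by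
  rw [inner_eq_pairing, inner_eq_pairing, pairing_congr (crossL2_ae a F) (ae_eq_refl _),
    pairing_congr (ae_eq_refl _) (crossL2_ae a G), pairing, pairing, ← integral_neg]
  simp only [inner_crossB_left]

theorem crossL2_translate (a y : E3) (F : L2Field) :
    crossL2 a (translate y F) = translate y (crossL2 a F) := by
  apply Lp.ext
  have h1 := (measurePreserving_sub_right (volume : Measure E3) y).quasiMeasurePreserving.ae
    (crossL2_ae a F)
  filter_upwards [crossL2_ae a (translate y F), translate_ae y F, translate_ae y (crossL2 a F), h1]
    with x h2 h3 h4 h5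
  rw [h2, h3, h4, h5]

theorem inner_toL2_crossL2 {ψ : E3 → E3} (hψ : IsTest ψ) (a : E3) (F : L2Field) :
    inner ℝ (hψ.clm_comp (crossB a)).toL2 F = -inner ℝ hψ.toL2 (crossL2 a F) := by
  rw [← inner_crossL2_left]
  rfl

/-! ### Weak derivatives of mollified fields -/

/-- The correlation `y ↦ ∫ ψ(x) · F(x - y) dx` of a test field with an `L²` field is a convolution,
hence differentiable. -/
theorem hasFDerivAt_inner_translate {ψ : E3 → E3} (hψ : IsTest ψ) (F : L2Field) (y : E3) :
    ∃ L : E3 →L[ℝ] ℝ, HasFDerivAt (fun y => inner ℝ hψ.toL2 (translate y F)) L y ∧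
      ∀ v, L v = inner ℝ (hψ.fderiv_apply v).toL2 (translate y F) := by
  let G : E3 → E3 := fun x => F (-x)
  have hG : LocallyIntegrable G (volume : Measure E3) :=
    ((Lp.memLp F).comp_measurePreserving
      (Measure.measurePreserving_neg (volume : Measure E3))).locallyIntegrable (by norm_num)
  have key : ∀ χ : E3 → E3, ∀ hχ : IsTest χ, ∀ y, inner ℝ hχ.toL2 (translate y F) =
      (G ⋆[innerSL ℝ, volume] χ) y := by
    intro χ hχ y
    rw [hχ.inner_toL2, pairing_congr (ae_eq_refl _) (translate_ae y F), pairing, convolution_def,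
      ← integral_sub_left_eq_self _ volume y]
    congr 1
    ext t
    rw [real_inner_comm, sub_sub_cancel_left]
    rfl
  refine ⟨(G ⋆[(innerSL ℝ).precompR E3, volume] fderiv ℝ ψ) y, ?_, fun v => ?_⟩
  · simp only [key ψ hψ]
    exact hψ.2.hasFDerivAt_convolution_right (innerSL ℝ) hG
      (hψ.1.of_le (by exact_mod_cast le_top)) y
  · rw [key _ (hψ.fderiv_apply v), convolution_precompR_apply _ hG (hψ.2.fderiv ℝ)
      (hψ.1.continuous_fderiv (by simp))]

/-- The weight given by a smooth bump, normalized to have integral one. -/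
noncomputable def bumpWeight (b : ContDiffBump (0 : E3)) : Weight :=
  ⟨b.normed volume, b.continuous_normed, b.hasCompactSupport_normed⟩

theorem contDiff_bumpWeight (b : ContDiffBump (0 : E3)) : ContDiff ℝ ∞ (b.normed volume) :=
  b.contDiff_normed

/-- The weight given by a directional derivative of a normalized bump. -/
noncomputable def bumpDerivWeight (b : ContDiffBump (0 : E3)) (v : E3) : Weight where
  toFun x := fderiv ℝ (b.normed volume) x v
  cont := ((contDiff_bumpWeight b).continuous_fderiv (by simp)).clm_apply continuous_const
  supp := b.hasCompactSupport_normed.fderiv_apply ℝ v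

/-- A mollified field is weakly differentiable, with derivative the convolution with the
derivative of the bump. -/
theorem inner_fderiv_avg {ψ : E3 → E3} (hψ : IsTest ψ) (b : ContDiffBump (0 : E3)) (v : E3)
    (F : L2Field) :
    inner ℝ (hψ.fderiv_apply v).toL2 ((bumpWeight b).avg F) =
      -inner ℝ hψ.toL2 ((bumpDerivWeight b v).avg F) := by
  rw [Weight.inner_avg, Weight.inner_avg]
  choose L hL hLv using hasFDerivAt_inner_translate hψ F
  have hfd : ∀ y, fderiv ℝ (fun y => inner ℝ hψ.toL2 (translate y F)) y v =
      inner ℝ (hψ.fderiv_apply v).toL2 (translate y F) := fun y => by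
    rw [(hL y).fderiv, hLv]
  have hc : ∀ χ : L2Field, Continuous fun y => inner ℝ χ (translate y F) := fun χ =>
    continuous_const.inner (continuous_translate F)
  have h := integral_mul_fderiv_eq_neg_fderiv_mul_of_integrable (μ := (volume : Measure E3))
    (f := b.normed volume) (g := fun y => inner ℝ hψ.toL2 (translate y F)) (v := v) ?_ ?_ ?_ ?_ ?_
  · simp only [hfd] at h
    exact h
  · exact ((bumpDerivWeight b v).cont.mul (hc _)).integrable_of_hasCompactSupport
      (bumpDerivWeight b v).supp.mul_right
  · simp only [hfd]
    exact ((bumpWeight b).cont.mul (hc _)).integrable_of_hasCompactSupport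
      (bumpWeight b).supp.mul_right
  · exact ((bumpWeight b).cont.mul (hc _)).integrable_of_hasCompactSupport
      (bumpWeight b).supp.mul_right
  · exact fun x _ => (contDiff_bumpWeight b).differentiable (by simp) x
  · exact fun x _ => (hL x).differentiableAt

theorem inner_bumpWeight_avg_left (b : ContDiffBump (0 : E3)) (F G : L2Field) :
    inner ℝ ((bumpWeight b).avg F) G = inner ℝ F ((bumpWeight b).avg G) := by
  rw [Weight.inner_avg_left, Weight.inner_avg]
  simp only [bumpWeight, ContDiffBump.normed_neg]

theorem inner_bumpDerivWeight_avg_left (b : ContDiffBump (0 : E3)) (v : E3) (F G : L2Field) :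
    inner ℝ ((bumpDerivWeight b v).avg F) G = -inner ℝ F ((bumpDerivWeight b v).avg G) := by
  rw [Weight.inner_avg_left, Weight.inner_avg, ← integral_neg]
  congr 1
  ext y
  have hodd : fderiv ℝ (b.normed volume) (-y) v = -fderiv ℝ (b.normed volume) y v := by
    have h1 : HasFDerivAt (b.normed volume) (fderiv ℝ (b.normed volume) (-y)) (-y) :=
      ((contDiff_bumpWeight b).differentiable (by simp) (-y)).hasFDerivAt
    have h2 := h1.comp y (hasFDerivAt_id y).neg
    have h3 : (b.normed volume) ∘ (Neg.neg : E3 → E3) = b.normed volume :=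
      funext fun x => b.normed_neg x
    rw [h3] at h2
    rw [h2.fderiv]
    simp
  change fderiv ℝ (b.normed volume) (-y) v * _ = -(fderiv ℝ (b.normed volume) y v * _)
  rw [hodd, neg_mul]

theorem tendsto_bumpWeight_avg {b : ℕ → ContDiffBump (0 : E3)}
    (hb : Tendsto (fun n => (b n).rOut) atTop (𝓝 0)) (F : L2Field) :
    Tendsto (fun n => (bumpWeight (b n)).avg F) atTop (𝓝 F) := by
  have h := ContDiffBump.convolution_tendsto_right_of_continuous (μ := (volume : Measure E3)) hb
    ((continuous_translate F).comp continuous_neg) 0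
  simp only [Function.comp_apply, neg_zero, translate_zero] at h
  refine h.congr fun n => ?_
  rw [convolution_def, Weight.avg_apply]
  simp [bumpWeight]

/-! ### The mollified curl -/

/-- The operator `F ↦ ∇ × (η ∗ F)` for a normalized bump `η`; it is bounded on `L²`. -/
noncomputable def curlAvg (b : ContDiffBump (0 : E3)) : L2Field →L[ℝ] L2Field :=
  ∑ i : Fin 3, (crossL2 (basisVec i)).comp (bumpDerivWeight b (basisVec i)).avg

theorem curlAvg_apply (b : ContDiffBump (0 : E3)) (F : L2Field) : curlAvg b F =
    ∑ i : Fin 3, crossL2 (basisVec i) ((bumpDerivWeight b (basisVec i)).avg F) := by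
  simp [curlAvg]

theorem toL2_curl {ψ : E3 → E3} (hψ : IsTest ψ) : hψ.curl.toL2 =
    ∑ i : Fin 3, ((hψ.fderiv_apply (basisVec i)).clm_comp (crossB (basisVec i))).toL2 := by
  apply Lp.ext
  have hi := fun i : Fin 3 =>
    ((hψ.fderiv_apply (basisVec i)).clm_comp (crossB (basisVec i))).memLp.coeFn_toLp
  rw [Fin.sum_univ_three]
  refine (hψ.curl.memLp.coeFn_toLp).trans ?_
  refine EventuallyEq.trans ?_ (Lp.coeFn_add _ _).symm
  refine EventuallyEq.trans ?_ ((Lp.coeFn_add _ _).symm.add (EventuallyEq.refl _ _))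
  filter_upwards [hi 0, hi 1, hi 2] with x h0 h1 h2
  rw [curl_eq_sum, Fin.sum_univ_three, ← h0, ← h1, ← h2]
  rfl

theorem inner_curl_avg {ψ : E3 → E3} (hψ : IsTest ψ) (b : ContDiffBump (0 : E3)) (F : L2Field) :
    inner ℝ hψ.curl.toL2 ((bumpWeight b).avg F) = inner ℝ hψ.toL2 (curlAvg b F) := by
  rw [toL2_curl hψ, sum_inner, curlAvg_apply, inner_sum]
  refine Finset.sum_congr rfl fun i _ => ?_
  rw [inner_toL2_crossL2 (hψ.fderiv_apply _), (bumpWeight b).avg_comm _ (crossL2_translate _),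
    inner_fderiv_avg hψ, neg_neg, Weight.avg_comm _ _ (crossL2_translate _)]

theorem inner_curlAvg_left (b : ContDiffBump (0 : E3)) (F G : L2Field) :
    inner ℝ (curlAvg b F) G = inner ℝ F (curlAvg b G) := by
  rw [curlAvg_apply, sum_inner, curlAvg_apply, inner_sum]
  refine Finset.sum_congr rfl fun i _ => ?_
  rw [inner_crossL2_left, inner_bumpDerivWeight_avg_left, neg_neg,
    Weight.avg_comm _ _ (crossL2_translate _)]

theorem curlAvg_toL2 {ψ : E3 → E3} (hψ : IsTest ψ) (b : ContDiffBump (0 : E3)) :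
    curlAvg b hψ.toL2 = (bumpWeight b).avg hψ.curl.toL2 := by
  refine ext_inner_right ℝ fun G => ?_
  rw [inner_curlAvg_left, ← inner_curl_avg, inner_bumpWeight_avg_left]

theorem curlAvg_translate (b : ContDiffBump (0 : E3)) (y : E3) (F : L2Field) :
    curlAvg b (translate y F) = translate y (curlAvg b F) := by
  simp only [curlAvg_apply, map_sum, Weight.avg_translate, crossL2_translate]

theorem curlAvg_avg (b : ContDiffBump (0 : E3)) (η : Weight) (F : L2Field) :
    curlAvg b (η.avg F) = η.avg (curlAvg b F) :=
  η.avg_comm _ (curlAvg_translate b) F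

/-! ### The free Maxwell evolution -/

/-- `g = ∇ × f` in the sense of distributions, for square integrable fields. -/
def IsWeakCurl (f g : L2Field) : Prop :=
  ∀ ψ : E3 → E3, ∀ hψ : IsTest ψ, inner ℝ hψ.toL2 g = inner ℝ hψ.curl.toL2 f

/-- Mollification respects weak curls, since translates of test fields are test fields. -/
theorem IsWeakCurl.avg {f g : L2Field} (h : IsWeakCurl f g) (η : Weight) :
    IsWeakCurl (η.avg f) (η.avg g) := by
  intro ψ hψ
  rw [Weight.inner_avg, Weight.inner_avg]
  congr 1
  ext y
  have h2 : (hψ.curl.comp_add_right y).toL2 = (hψ.comp_add_right y).curl.toL2 := by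
    apply Lp.ext
    filter_upwards [(hψ.curl.comp_add_right y).memLp.coeFn_toLp,
      (hψ.comp_add_right y).curl.memLp.coeFn_toLp] with x h3 h4
    refine h3.trans (Eq.trans ?_ h4.symm)
    rw [curl_comp_add_right]
  have h5 : ∀ F G : L2Field, inner ℝ F (translate y G) = inner ℝ (translate (-y) F) G := by
    intro F G
    rw [inner_translate_left, neg_neg]
  rw [h5, h5, hψ.translate_toL2, hψ.curl.translate_toL2, h2, h _ (hψ.comp_add_right y)]

/-- Pairs `(E, B)` of square integrable fields, as a Hilbert space. -/
abbrev Fields : Type := WithLp 2 (L2Field × L2Field)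

theorem Fields.inner_def (F G : Fields) :
    inner ℝ F G = inner ℝ F.fst G.fst + inner ℝ F.snd G.snd :=
  WithLp.prod_inner_apply F G

theorem Fields.norm_sq (F : Fields) : ‖F‖ ^ 2 = ‖F.fst‖ ^ 2 + ‖F.snd‖ ^ 2 :=
  WithLp.prod_norm_sq_eq_of_L2 F

/-- The bounded operator on pairs of fields built from a bounded map of `L² × L²`. -/
noncomputable def Fields.liftCLM (L : L2Field × L2Field →L[ℝ] L2Field × L2Field) :
    Fields →L[ℝ] Fields :=
  ((WithLp.prodContinuousLinearEquiv 2 ℝ L2Field L2Field).symm :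
      L2Field × L2Field →L[ℝ] Fields).comp
    (L.comp (WithLp.prodContinuousLinearEquiv 2 ℝ L2Field L2Field :
      Fields →L[ℝ] L2Field × L2Field))

theorem Fields.ext {F G : Fields} (h1 : F.fst = G.fst) (h2 : F.snd = G.snd) : F = G :=
  (WithLp.ofLp_injective 2) (Prod.ext h1 h2)

/-- The mollification of both fields. -/
noncomputable def fieldsAvg (b : ContDiffBump (0 : E3)) : Fields →L[ℝ] Fields :=
  Fields.liftCLM ((bumpWeight b).avg.prodMap (bumpWeight b).avg)

/-- The mollified Maxwell operator `(E, B) ↦ (∇ × B, -∇ × E)`. -/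
noncomputable def maxwellAvg (b : ContDiffBump (0 : E3)) : Fields →L[ℝ] Fields :=
  Fields.liftCLM (((curlAvg b).comp (ContinuousLinearMap.snd ℝ L2Field L2Field)).prod
    (-(curlAvg b).comp (ContinuousLinearMap.fst ℝ L2Field L2Field)))

theorem fieldsAvg_fst (b : ContDiffBump (0 : E3)) (F : Fields) :
    (fieldsAvg b F).fst = (bumpWeight b).avg F.fst := rfl

theorem fieldsAvg_snd (b : ContDiffBump (0 : E3)) (F : Fields) :
    (fieldsAvg b F).snd = (bumpWeight b).avg F.snd := rfl

theorem maxwellAvg_fst (b : ContDiffBump (0 : E3)) (F : Fields) :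
    (maxwellAvg b F).fst = curlAvg b F.snd := rfl

theorem maxwellAvg_snd (b : ContDiffBump (0 : E3)) (F : Fields) :
    (maxwellAvg b F).snd = -curlAvg b F.fst := rfl

/-- A sequence of bumps shrinking to the origin. -/
noncomputable def bumpSeq (n : ℕ) : ContDiffBump (0 : E3) where
  rIn := 1 / (n + 1) / 2
  rOut := 1 / (n + 1)
  rIn_pos := by positivity
  rIn_lt_rOut := half_lt_self (by positivity)

theorem tendsto_bumpSeq : Tendsto (fun n => (bumpSeq n).rOut) atTop (𝓝 0) :=
  tendsto_one_div_add_atTop_nhds_zero_nat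

/-- Smooth compactly supported vector fields. -/
abbrev TestField : Type := {ψ : E3 → E3 // IsTest ψ}

theorem isTest_zero : IsTest (fun _ : E3 => (0 : E3)) := ⟨contDiff_const, .zero⟩

theorem curl_zero : curl (fun _ : E3 => (0 : E3)) = fun _ => 0 := by
  funext x
  simp [curl_eq_sum]

theorem inner_toL2_zero (F : L2Field) : inner ℝ isTest_zero.toL2 F = 0 := by
  rw [isTest_zero.inner_toL2]
  simp [pairing]

theorem inner_toL2_curl_zero (F : L2Field) : inner ℝ isTest_zero.curl.toL2 F = 0 := by
  rw [isTest_zero.curl.inner_toL2, curl_zero]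
  simp [pairing]

/-- The Maxwell operator `(E, B) ↦ (∇ × B, -∇ × E)` on pairs of test fields, with its
mollifications. -/
noncomputable def maxwell : SkewApprox Fields (TestField × TestField) where
  e i := WithLp.toLp 2 (i.1.2.toL2, i.2.2.toL2)
  a i := WithLp.toLp 2 (i.2.2.curl.toL2, -i.1.2.curl.toL2)
  S n := fieldsAvg (bumpSeq n)
  A n := maxwellAvg (bumpSeq n)
  total F h := by
    refine Fields.ext ?_ ?_
    · refine eq_zero_of_inner_toL2 fun ψ hψ => ?_
      have h1 := h (⟨ψ, hψ⟩, ⟨_, isTest_zero⟩)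
      rw [Fields.inner_def] at h1
      simpa only [WithLp.toLp_fst, WithLp.toLp_snd, inner_toL2_zero, add_zero] using h1
    · refine eq_zero_of_inner_toL2 fun ψ hψ => ?_
      have h1 := h (⟨_, isTest_zero⟩, ⟨ψ, hψ⟩)
      rw [Fields.inner_def] at h1
      simpa only [WithLp.toLp_fst, WithLp.toLp_snd, inner_toL2_zero, zero_add] using h1
  S_symm n F G := by
    simp only [Fields.inner_def, fieldsAvg_fst, fieldsAvg_snd, inner_bumpWeight_avg_left]
  S_tendsto F := by
    have h1 := tendsto_bumpWeight_avg tendsto_bumpSeq F.fst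
    have h2 := tendsto_bumpWeight_avg tendsto_bumpSeq F.snd
    exact ((WithLp.prodContinuousLinearEquiv 2 ℝ L2Field L2Field).symm.continuous.tendsto
      (F.fst, F.snd)).comp (h1.prodMk_nhds h2)
  A_skew n F G := by
    simp only [Fields.inner_def, maxwellAvg_fst, maxwellAvg_snd, inner_neg_left, inner_neg_right,
      inner_curlAvg_left]
    ring
  A_e n i := by
    refine Fields.ext ?_ ?_
    · rw [maxwellAvg_fst, fieldsAvg_fst]
      exact curlAvg_toL2 i.2.2 _
    · rw [maxwellAvg_snd, fieldsAvg_snd]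
      simp only [WithLp.toLp_fst, WithLp.toLp_snd, map_neg]
      rw [curlAvg_toL2 i.1.2]
  A_S n m F := by
    refine Fields.ext ?_ ?_
    · simp only [maxwellAvg_fst, fieldsAvg_fst, fieldsAvg_snd, curlAvg_avg]
    · simp only [maxwellAvg_snd, fieldsAvg_fst, fieldsAvg_snd, curlAvg_avg, map_neg]
  graph_S F G h n i := by
    have hE : IsWeakCurl F.snd G.fst := by
      intro ψ hψ
      have h1 := h (⟨ψ, hψ⟩, ⟨_, isTest_zero⟩)
      rw [Fields.inner_def, Fields.inner_def] at h1
      simpa only [WithLp.toLp_fst, WithLp.toLp_snd, inner_toL2_zero, inner_toL2_curl_zero,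
        inner_neg_left, neg_neg, zero_add, add_zero] using h1
    have hB : IsWeakCurl (-F.fst) G.snd := by
      intro ψ hψ
      have h1 := h (⟨_, isTest_zero⟩, ⟨ψ, hψ⟩)
      rw [Fields.inner_def, Fields.inner_def] at h1
      simpa only [WithLp.toLp_fst, WithLp.toLp_snd, inner_toL2_zero, inner_toL2_curl_zero,
        inner_neg_left, inner_neg_right, neg_zero, zero_add, add_zero] using h1
    have hE' := hE.avg (bumpWeight (bumpSeq n)) i.1.1 i.1.2
    have hB' := hB.avg (bumpWeight (bumpSeq n)) i.2.1 i.2.2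
    rw [map_neg, inner_neg_right] at hB'
    simp only [Fields.inner_def, fieldsAvg_fst, fieldsAvg_snd, WithLp.toLp_fst, WithLp.toLp_snd,
      inner_neg_left]
    rw [hE', hB']
    ring

/-! ### The velocity as a function of the momentum variable -/

/-- The velocity `v = u / √(1 + |u|²)` that belongs to `u = γ(v) v`. -/
noncomputable def vel (u : E3) : E3 := (1 / Real.sqrt (1 + ‖u‖ ^ 2)) • u

theorem sqrt_one_add_pos (u : E3) : 0 < Real.sqrt (1 + ‖u‖ ^ 2) := by positivity

theorem norm_lt_sqrt_one_add (u : E3) : ‖u‖ < Real.sqrt (1 + ‖u‖ ^ 2) :=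
  Real.lt_sqrt_of_sq_lt (by linarith)

theorem norm_vel (u : E3) : ‖vel u‖ = ‖u‖ / Real.sqrt (1 + ‖u‖ ^ 2) := by
  rw [vel, norm_smul, Real.norm_of_nonneg (by positivity)]
  ring

theorem norm_vel_lt (u : E3) : ‖vel u‖ < 1 := by
  rw [norm_vel, div_lt_one (sqrt_one_add_pos u)]
  exact norm_lt_sqrt_one_add u

theorem gammaFactor_vel (u : E3) : gammaFactor (vel u) = Real.sqrt (1 + ‖u‖ ^ 2) := by
  have h : 1 - ‖vel u‖ ^ 2 = 1 / (1 + ‖u‖ ^ 2) := by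
    rw [norm_vel, div_pow, Real.sq_sqrt (by positivity)]
    field_simp
    ring
  rw [gammaFactor, h, Real.sqrt_div zero_le_one, Real.sqrt_one, one_div_one_div]

theorem gammaFactor_smul_vel (u : E3) : gammaFactor (vel u) • vel u = u := by
  rw [gammaFactor_vel, vel, smul_smul, mul_one_div_cancel (sqrt_one_add_pos u).ne', one_smul]

theorem vel_gammaFactor_smul {v : E3} (hv : ‖v‖ < 1) : vel (gammaFactor v • v) = v :=
  gammaFactor_smul_injective (norm_vel_lt _) hv (gammaFactor_smul_vel _)

theorem abs_sqrt_one_add_sub_le (u w : E3) :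
    |Real.sqrt (1 + ‖u‖ ^ 2) - Real.sqrt (1 + ‖w‖ ^ 2)| ≤ ‖u - w‖ := by
  have hu := sqrt_one_add_pos u
  have hw := sqrt_one_add_pos w
  have h1 : (Real.sqrt (1 + ‖u‖ ^ 2) - Real.sqrt (1 + ‖w‖ ^ 2)) *
      (Real.sqrt (1 + ‖u‖ ^ 2) + Real.sqrt (1 + ‖w‖ ^ 2)) = (‖u‖ - ‖w‖) * (‖u‖ + ‖w‖) := by
    have := Real.sq_sqrt (show 0 ≤ 1 + ‖u‖ ^ 2 by positivity)
    have := Real.sq_sqrt (show 0 ≤ 1 + ‖w‖ ^ 2 by positivity)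
    nlinarith
  have h2 : |Real.sqrt (1 + ‖u‖ ^ 2) - Real.sqrt (1 + ‖w‖ ^ 2)| *
      (Real.sqrt (1 + ‖u‖ ^ 2) + Real.sqrt (1 + ‖w‖ ^ 2)) ≤
      ‖u - w‖ * (Real.sqrt (1 + ‖u‖ ^ 2) + Real.sqrt (1 + ‖w‖ ^ 2)) := by
    rw [← abs_of_pos (add_pos hu hw), ← abs_mul, h1, abs_mul, abs_of_pos (add_pos hu hw),
      abs_of_nonneg (by positivity : 0 ≤ ‖u‖ + ‖w‖)]
    have := norm_lt_sqrt_one_add u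
    have := norm_lt_sqrt_one_add w
    exact mul_le_mul (abs_norm_sub_norm_le u w) (by linarith) (by positivity) (norm_nonneg _)
  exact le_of_mul_le_mul_right h2 (add_pos hu hw)

theorem norm_vel_sub_le (u w : E3) : ‖vel u - vel w‖ ≤ 2 * ‖u - w‖ := by
  set a := Real.sqrt (1 + ‖u‖ ^ 2) with ha
  set b := Real.sqrt (1 + ‖w‖ ^ 2) with hb
  have ha1 : 1 ≤ a := Real.one_le_sqrt.2 (by nlinarith [sq_nonneg ‖u‖])
  have hbpos : 0 < b := sqrt_one_add_pos w
  have h1 : vel u - vel w = (1 / a) • (u - w) + ((b - a) / a) • vel w := by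
    have hwv : w = b • vel w := by
      rw [vel, smul_smul, ← hb, mul_one_div_cancel hbpos.ne', one_smul]
    have h2 : vel u = (1 / a) • u := rfl
    rw [h2]
    nth_rw 2 [hwv]
    rw [smul_sub, smul_smul, sub_add, ← sub_smul]
    have h3 : 1 / a * b - (b - a) / a = 1 := by field_simp; ring
    rw [h3, one_smul]
  have h4 : ‖(1 / a) • (u - w)‖ ≤ ‖u - w‖ := by
    rw [norm_smul, Real.norm_of_nonneg (by positivity)]
    exact mul_le_of_le_one_left (norm_nonneg _) ((div_le_one (by linarith)).2 ha1)
  have h5 : ‖((b - a) / a) • vel w‖ ≤ ‖u - w‖ := by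
    rw [norm_smul, norm_div, Real.norm_eq_abs, Real.norm_of_nonneg (by linarith : 0 ≤ a)]
    have h6 : |b - a| ≤ ‖u - w‖ := by
      rw [norm_sub_rev]
      exact abs_sqrt_one_add_sub_le w u
    have h7 : |b - a| / a ≤ |b - a| := div_le_self (abs_nonneg _) ha1
    calc |b - a| / a * ‖vel w‖ ≤ |b - a| / a * 1 := by
          gcongr
          exact (norm_vel_lt w).le
      _ ≤ ‖u - w‖ := by linarith
  rw [h1]
  linarith [norm_add_le ((1 / a) • (u - w)) (((b - a) / a) • vel w)]

/-! ### Bounded Lipschitz maps -/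

section BoundedLipschitz

variable {X V W Z : Type*} [NormedAddCommGroup X] [NormedAddCommGroup V] [NormedAddCommGroup W]
  [NormedAddCommGroup Z]

/-- Bounded Lipschitz maps between normed spaces. -/
def BddLip (h : V → W) : Prop :=
  ∃ C : ℝ, ∀ x y, ‖h x‖ ≤ C ∧ ‖h x - h y‖ ≤ C * ‖x - y‖

theorem BddLip.continuous {h : V → W} (hh : BddLip h) : Continuous h := by
  obtain ⟨C, hC⟩ := hh
  have hC0 : 0 ≤ C := (norm_nonneg _).trans (hC 0 0).1
  exact (LipschitzWith.of_dist_le_mul (K := ⟨C, hC0⟩) fun x y => by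
    rw [dist_eq_norm, dist_eq_norm]; exact (hC x y).2).continuous

theorem bddLip_vel : BddLip vel :=
  ⟨2, fun u w => ⟨(norm_vel_lt u).le.trans one_le_two, norm_vel_sub_le u w⟩⟩

/-- Families of maps that are bounded and Lipschitz on balls, uniformly in the parameter. -/
def BddLipOnBalls (f : ℝ → X → V) : Prop :=
  ∀ r : ℝ, ∃ C : ℝ, ∀ t, ∀ x ∈ Metric.closedBall (0 : X) r, ∀ y ∈ Metric.closedBall (0 : X) r,
    ‖f t x‖ ≤ C ∧ ‖f t x - f t y‖ ≤ C * ‖x - y‖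

theorem bddLipOnBalls_clm [NormedSpace ℝ X] [NormedSpace ℝ V] (L : X →L[ℝ] V) :
    BddLipOnBalls fun _ x => L x := by
  intro r
  refine ⟨‖L‖ * max r 1, fun t x hx y _ => ⟨(L.le_opNorm x).trans ?_, ?_⟩⟩
  · gcongr
    exact (mem_closedBall_zero_iff.1 hx).trans (le_max_left _ _)
  · rw [← map_sub]
    refine (L.le_opNorm _).trans ?_
    rw [mul_assoc]
    gcongr
    exact le_mul_of_one_le_left (norm_nonneg _) (le_max_right _ _)

theorem BddLipOnBalls.isometry_comp [NormedSpace ℝ V] [NormedSpace ℝ W] {f : ℝ → X → V}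
    (hf : BddLipOnBalls f)
    (T : ℝ → V →ₗᵢ[ℝ] W) : BddLipOnBalls fun t x => T t (f t x) := by
  intro r
  obtain ⟨C, hC⟩ := hf r
  refine ⟨C, fun t x hx y hy => ?_⟩
  rw [← map_sub, LinearIsometry.norm_map, LinearIsometry.norm_map]
  exact hC t x hx y hy

theorem BddLipOnBalls.clm_comp [NormedSpace ℝ V] [NormedSpace ℝ W] {f : ℝ → X → V}
    (hf : BddLipOnBalls f) (L : V →L[ℝ] W) :
    BddLipOnBalls fun t x => L (f t x) := by
  intro r
  obtain ⟨C, hC⟩ := hf r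
  refine ⟨‖L‖ * C, fun t x hx y hy => ⟨(L.le_opNorm _).trans ?_, ?_⟩⟩
  · gcongr
    exact (hC t x hx y hy).1
  · rw [← map_sub, mul_assoc]
    refine (L.le_opNorm _).trans ?_
    gcongr
    exact (hC t x hx y hy).2

theorem BddLipOnBalls.bddLip_comp {f : ℝ → X → V} (hf : BddLipOnBalls f) {h : V → W}
    (hh : BddLip h) : BddLipOnBalls fun t x => h (f t x) := by
  intro r
  obtain ⟨C, hC⟩ := hf r
  obtain ⟨D, hD⟩ := hh
  have hD0 : 0 ≤ D := (norm_nonneg _).trans (hD 0 0).1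
  refine ⟨D * max C 1, fun t x hx y hy => ⟨?_, ?_⟩⟩
  · exact (hD _ 0).1.trans (le_mul_of_one_le_right hD0 (le_max_right _ _))
  · rw [mul_assoc]
    refine (hD _ _).2.trans ?_
    gcongr
    refine (hC t x hx y hy).2.trans ?_
    gcongr
    exact le_max_left _ _

theorem BddLipOnBalls.add {f g : ℝ → X → V} (hf : BddLipOnBalls f) (hg : BddLipOnBalls g) :
    BddLipOnBalls fun t x => f t x + g t x := by
  intro r
  obtain ⟨C, hC⟩ := hf r
  obtain ⟨D, hD⟩ := hg r
  refine ⟨C + D, fun t x hx y hy => ⟨?_, ?_⟩⟩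
  · exact (norm_add_le _ _).trans (add_le_add (hC t x hx y hy).1 (hD t x hx y hy).1)
  · rw [add_sub_add_comm, add_mul]
    exact (norm_add_le _ _).trans (add_le_add (hC t x hx y hy).2 (hD t x hx y hy).2)

theorem BddLipOnBalls.prodMk {f : ℝ → X → V} {g : ℝ → X → W} (hf : BddLipOnBalls f)
    (hg : BddLipOnBalls g) : BddLipOnBalls fun t x => (f t x, g t x) := by
  intro r
  obtain ⟨C, hC⟩ := hf r
  obtain ⟨D, hD⟩ := hg r
  refine ⟨max C D, fun t x hx y hy => ⟨?_, ?_⟩⟩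
  · exact max_le_max (hC t x hx y hy).1 (hD t x hx y hy).1
  · refine max_le ((hC t x hx y hy).2.trans ?_) ((hD t x hx y hy).2.trans ?_)
    · gcongr
      exact le_max_left _ _
    · gcongr
      exact le_max_right _ _

theorem BddLipOnBalls.bilin [NormedSpace ℝ V] [NormedSpace ℝ W] [NormedSpace ℝ Z]
    {f : ℝ → X → V} {g : ℝ → X → W} (B : V →L[ℝ] W →L[ℝ] Z)
    (hf : BddLipOnBalls f) (hg : BddLipOnBalls g) : BddLipOnBalls fun t x => B (f t x) (g t x) := by
  intro r
  obtain ⟨C, hC⟩ := hf r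
  obtain ⟨D, hD⟩ := hg r
  refine ⟨max (‖B‖ * C * D) (2 * (‖B‖ * C * D)), fun t x hx y hy => ⟨?_, ?_⟩⟩
  · have hf1 := (hC t x hx y hy).1
    have hg1 := (hD t x hx y hy).1
    have hC0 : 0 ≤ C := (norm_nonneg _).trans hf1
    refine le_max_of_le_left ((B.le_opNorm₂ _ _).trans ?_)
    gcongr
  · have hf1 := (hC t y hy x hx).1
    have hg1 := (hD t x hx y hy).1
    have hC0 : 0 ≤ C := (norm_nonneg _).trans hf1
    have hD0 : 0 ≤ D := (norm_nonneg _).trans hg1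
    have h1 : B (f t x) (g t x) - B (f t y) (g t y) =
        B (f t x - f t y) (g t x) + B (f t y) (g t x - g t y) := by
      simp only [map_sub, sub_apply]
      abel
    have h2 : ‖B (f t x - f t y) (g t x)‖ ≤ ‖B‖ * (C * ‖x - y‖) * D := by
      refine (B.le_opNorm₂ _ _).trans ?_
      gcongr
      exact (hC t x hx y hy).2
    have h3 : ‖B (f t y) (g t x - g t y)‖ ≤ ‖B‖ * C * (D * ‖x - y‖) := by
      refine (B.le_opNorm₂ _ _).trans ?_
      gcongr
      exact (hD t x hx y hy).2
    rw [h1]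
    refine (norm_add_le _ _).trans ((add_le_add h2 h3).trans ?_)
    calc ‖B‖ * (C * ‖x - y‖) * D + ‖B‖ * C * (D * ‖x - y‖) = 2 * (‖B‖ * C * D) * ‖x - y‖ := by ring
      _ ≤ _ := by
        gcongr
        exact le_max_right _ _

theorem BddLipOnBalls.lipschitzOnWith {f : ℝ → X → V} (hf : BddLipOnBalls f) (r : ℝ) :
    ∃ K : NNReal, ∀ t, LipschitzOnWith K (f t) (Metric.closedBall 0 r) := by
  obtain ⟨C, hC⟩ := hf r
  refine ⟨C.toNNReal, fun t => LipschitzOnWith.of_dist_le_mul fun x hx y hy => ?_⟩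
  rw [dist_eq_norm, dist_eq_norm]
  refine (hC t x hx y hy).2.trans ?_
  gcongr
  exact Real.le_coe_toNNReal C

end BoundedLipschitz

/-! ### The external fields -/

section External

variable {V : Type*} [NormedAddCommGroup V] [NormedSpace ℝ V]

theorem bddLip_fderiv {f : E3 → V} (hf : ContDiff ℝ ∞ f) {C : ℝ}
    (h1 : ∀ x, ‖iteratedFDeriv ℝ 1 f x‖ ≤ C) (h2 : ∀ x, ‖iteratedFDeriv ℝ 2 f x‖ ≤ C) :
    BddLip (fderiv ℝ f) := by
  refine ⟨C, fun x y => ⟨?_, ?_⟩⟩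
  · rw [← norm_iteratedFDeriv_one]
    exact h1 x
  · have hd : Differentiable ℝ (fderiv ℝ f) :=
      (hf.fderiv_right (m := ∞) (by simp)).differentiable (by simp)
    refine convex_univ.norm_image_sub_le_of_norm_fderiv_le (𝕜 := ℝ) (fun z _ => hd z)
      (fun z _ => ?_) trivial trivial
    rw [← norm_iteratedFDeriv_one, norm_iteratedFDeriv_fderiv]
    exact h2 z

theorem BddLip.clm_comp {X W : Type*} [NormedAddCommGroup X] [NormedAddCommGroup W]
    [NormedSpace ℝ W] {h : X → V} (hh : BddLip h) (L : V →L[ℝ] W) : BddLip fun x => L (h x) := by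
  obtain ⟨C, hC⟩ := hh
  refine ⟨‖L‖ * C, fun x y => ⟨(L.le_opNorm _).trans ?_, ?_⟩⟩
  · gcongr
    exact (hC x y).1
  · rw [← map_sub, mul_assoc]
    refine (L.le_opNorm _).trans ?_
    gcongr
    exact (hC x y).2

theorem bddLip_extE {φ : E3 → ℝ} {A : E3 → E3} (hP : ConditionP φ A) : BddLip (extE φ) := by
  obtain ⟨C, hC⟩ := hP.bounded
  obtain ⟨D, hD⟩ := bddLip_fderiv hP.smooth_phi (fun x => (hC 1 le_rfl (by norm_num) x).1)
    (fun x => (hC 2 (by norm_num) (by norm_num) x).1)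
  refine ⟨D, fun x y => ?_⟩
  rw [extE, extE, gradient, gradient, neg_sub_neg, norm_neg, ← map_sub,
    LinearIsometryEquiv.norm_map, LinearIsometryEquiv.norm_map, norm_sub_rev]
  exact hD x y

theorem bddLip_extB {φ : E3 → ℝ} {A : E3 → E3} (hP : ConditionP φ A) : BddLip (extB A) := by
  obtain ⟨C, hC⟩ := hP.bounded
  have h := (bddLip_fderiv hP.smooth_A (fun x => (hC 1 le_rfl (by norm_num) x).2)
    (fun x => (hC 2 (by norm_num) (by norm_num) x).2)).clm_comp
    (∑ i : Fin 3, (crossB (basisVec i)).comp (ContinuousLinearMap.apply ℝ E3 (basisVec i)))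
  have h2 : (fun x => (∑ i : Fin 3, (crossB (basisVec i)).comp
      (ContinuousLinearMap.apply ℝ E3 (basisVec i))) (fderiv ℝ A x)) = extB A := by
    funext x
    rw [extB, curl_eq_sum]
    simp
  rw [h2] at h
  exact h

/-- The average `∫ ρ(x - q) G(x) dx` of a field over the charge distribution centred at `q`. -/
noncomputable def smear (ρ : E3 → ℝ) (G : E3 → E3) (q : E3) : E3 := ∫ x, ρ (x - q) • G x

theorem smear_eq (ρ : E3 → ℝ) (G : E3 → E3) (q : E3) : smear ρ G q = ∫ x, ρ x • G (x + q) := by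
  rw [smear, ← integral_add_right_eq_self _ q]
  simp

theorem IsTest.integrable_smul {ρ : E3 → ℝ} (hρ : IsTest ρ) {G : E3 → V} (hG : Continuous G) :
    Integrable fun x => ρ x • G x :=
  (hρ.1.continuous.smul hG).integrable_of_hasCompactSupport hρ.2.smul_right

theorem BddLip.smear {ρ : E3 → ℝ} (hρ : IsTest ρ) {G : E3 → E3} (hG : BddLip G) :
    BddLip (smear ρ G) := by
  have hGc := hG.continuous
  obtain ⟨C, hC⟩ := hG
  have hint : Integrable fun x => ‖ρ x‖ :=
    (hρ.1.continuous.integrable_of_hasCompactSupport hρ.2).norm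
  refine ⟨(∫ x, ‖ρ x‖) * C, fun q p => ⟨?_, ?_⟩⟩
  · rw [smear_eq, ← integral_mul_const]
    refine norm_integral_le_of_norm_le (hint.mul_const C) (Eventually.of_forall fun x => ?_)
    rw [norm_smul]
    gcongr
    exact (hC _ 0).1
  · rw [smear_eq, smear_eq, ← integral_sub (hρ.integrable_smul (by fun_prop))
      (hρ.integrable_smul (by fun_prop)), mul_assoc, ← integral_mul_const]
    refine norm_integral_le_of_norm_le (hint.mul_const _) (Eventually.of_forall fun x => ?_)
    rw [← smul_sub, norm_smul]
    gcongr
    refine (hC _ _).2.trans ?_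
    rw [add_sub_add_left_eq_sub]

end External

/-! ### The charge distribution as an operator -/

theorem ConditionC.isTest {ρ : E3 → ℝ} {R e : ℝ} (hC : ConditionC ρ R e) : IsTest ρ :=
  ⟨hC.smooth, HasCompactSupport.intro (isCompact_closedBall 0 R) fun x hx => hC.support x (by
    simp only [Metric.mem_closedBall, dist_zero_right, not_le] at hx
    exact hx.le)⟩

section Charge

variable {ρ : E3 → ℝ} (hρ : IsTest ρ)

theorem IsTest.smul_const {ρ : E3 → ℝ} (hρ : IsTest ρ) (w : E3) : IsTest fun x => ρ x • w :=
  ⟨hρ.1.smul contDiff_const, hρ.2.smul_right⟩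

theorem IsTest.toL2_add {ψ χ ξ : E3 → E3} (hψ : IsTest ψ) (hχ : IsTest χ) (hξ : IsTest ξ)
    (h : ∀ x, ξ x = ψ x + χ x) : hξ.toL2 = hψ.toL2 + hχ.toL2 := by
  have : ξ = ψ + χ := funext h
  subst this
  rfl

theorem IsTest.toL2_smul {ψ ξ : E3 → E3} (c : ℝ) (hψ : IsTest ψ) (hξ : IsTest ξ)
    (h : ∀ x, ξ x = c • ψ x) : hξ.toL2 = c • hψ.toL2 := by
  have : ξ = c • ψ := funext h
  subst this
  rfl

/-- The map `w ↦ ρ w` from vectors to fields. -/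
noncomputable def chargeOpZero : E3 →L[ℝ] L2Field :=
  LinearMap.toContinuousLinearMap
    { toFun := fun w => (hρ.smul_const w).toL2
      map_add' := fun _ _ => IsTest.toL2_add _ _ _ fun _ => smul_add _ _ _
      map_smul' := fun c _ => IsTest.toL2_smul c _ _ fun _ => smul_comm _ _ _ }

/-- The map `w ↦ ρ(· - q) w` from vectors to fields. Its adjoint is the average
`F ↦ ∫ ρ(x - q) F(x) dx`. -/
noncomputable def chargeOp (q : E3) : E3 →L[ℝ] L2Field :=
  (translate q).toContinuousLinearMap.comp (chargeOpZero hρ)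

theorem chargeOp_apply (q w : E3) :
    chargeOp hρ q w = translate q (hρ.smul_const w).toL2 := rfl

theorem chargeOp_ae (q w : E3) : chargeOp hρ q w =ᵐ[volume] fun x => ρ (x - q) • w := by
  have h1 := (measurePreserving_sub_right (volume : Measure E3) q).quasiMeasurePreserving.ae
    (hρ.smul_const w).memLp.coeFn_toLp
  filter_upwards [translate_ae q (hρ.smul_const w).toL2, h1] with x h2 h3
  rw [chargeOp_apply, h2]
  exact h3

theorem norm_chargeOp_le (q : E3) : ‖chargeOp hρ q‖ ≤ ‖chargeOpZero hρ‖ := by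
  refine ContinuousLinearMap.opNorm_le_bound _ (norm_nonneg _) fun w => ?_
  change ‖translate q (chargeOpZero hρ w)‖ ≤ _
  rw [LinearIsometry.norm_map]
  exact (chargeOpZero hρ).le_opNorm w

/-- Translation acts in a Lipschitz way on test fields, because the pairings with all other fields
have derivatives with a uniform bound. -/
theorem exists_norm_translate_sub_le {ψ : E3 → E3} (hψ : IsTest ψ) :
    ∃ K, 0 ≤ K ∧ ∀ y z, ‖translate y hψ.toL2 - translate z hψ.toL2‖ ≤ K * ‖y - z‖ := by
  let D : E3 →L[ℝ] L2Field := LinearMap.toContinuousLinearMap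
    { toFun := fun v => (hψ.fderiv_apply v).toL2
      map_add' := fun v w => IsTest.toL2_add _ _ _ fun x => map_add _ _ _
      map_smul' := fun c v => IsTest.toL2_smul c _ _ fun x => map_smul _ _ _ }
  refine ⟨‖D‖, norm_nonneg _, fun y z => ?_⟩
  set N := translate y hψ.toL2 - translate z hψ.toL2 with hN
  choose L hL hLv using hasFDerivAt_inner_translate hψ N
  have hLn : ∀ y, ‖L y‖ ≤ ‖D‖ * ‖N‖ := fun y => by
    refine ContinuousLinearMap.opNorm_le_bound _ (by positivity) fun v => ?_
    rw [hLv]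
    refine (norm_inner_le_norm (D v) (translate y N)).trans ?_
    rw [LinearIsometry.norm_map, mul_right_comm]
    gcongr
    exact D.le_opNorm v
  have h1 := convex_univ.norm_image_sub_le_of_norm_hasFDerivWithin_le (x := -z) (y := -y)
    (fun y _ => (hL y).hasFDerivWithinAt) (fun y _ => hLn y) trivial trivial
  rw [← inner_translate_left, ← inner_translate_left, ← inner_sub_left, ← hN,
    real_inner_self_eq_norm_sq, Real.norm_of_nonneg (by positivity), neg_sub_neg,
    norm_sub_rev z y] at h1
  rcases (norm_nonneg N).eq_or_lt with h0 | h0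
  · rw [← h0]
    positivity
  · nlinarith

theorem bddLip_chargeOp : BddLip (chargeOp hρ) := by
  choose K hK0 hK using fun i : Fin 3 => exists_norm_translate_sub_le (hρ.smul_const (basisVec i))
  refine ⟨max ‖chargeOpZero hρ‖ (∑ i, K i),
    fun y z => ⟨(norm_chargeOp_le hρ y).trans (le_max_left _ _), ?_⟩⟩
  have h1 : ‖chargeOp hρ y - chargeOp hρ z‖ ≤ (∑ i, K i) * ‖y - z‖ := by
    refine ContinuousLinearMap.opNorm_le_bound _
      (mul_nonneg (Finset.sum_nonneg fun i _ => hK0 i) (norm_nonneg _)) fun w => ?_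
    have hw : w = ∑ i : Fin 3, w i • basisVec i := by
      ext j
      fin_cases j <;> simp [Fin.sum_univ_three]
    conv_lhs => rw [hw]
    rw [map_sum, Finset.sum_mul, Finset.sum_mul]
    refine (norm_sum_le _ _).trans (Finset.sum_le_sum fun i _ => ?_)
    rw [map_smul, norm_smul, mul_comm]
    exact mul_le_mul (hK i y z) (PiLp.norm_apply_le w i) (norm_nonneg _)
      (mul_nonneg (hK0 i) (norm_nonneg _))
  refine h1.trans ?_
  gcongr
  exact le_max_right _ _

/-- The average `F ↦ ∫ ρ(x - q) F(x) dx` over the charge distribution, as a bounded operator. -/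
noncomputable def chargeAvg (q : E3) : L2Field →L[ℝ] E3 :=
  ContinuousLinearMap.adjoint (chargeOp hρ q)

theorem bddLip_chargeAvg : BddLip (chargeAvg hρ) := by
  obtain ⟨C, hC⟩ := bddLip_chargeOp hρ
  refine ⟨C, fun q p => ?_⟩
  rw [chargeAvg, chargeAvg, ← map_sub, LinearIsometryEquiv.norm_map, LinearIsometryEquiv.norm_map]
  exact hC q p

theorem norm_chargeAvg_le (q : E3) : ‖chargeAvg hρ q‖ ≤ ‖chargeOpZero hρ‖ := by
  rw [chargeAvg, LinearIsometryEquiv.norm_map]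
  exact norm_chargeOp_le hρ q

theorem inner_chargeAvg (q w : E3) (F : L2Field) :
    inner ℝ w (chargeAvg hρ q F) = inner ℝ (chargeOp hρ q w) F :=
  ContinuousLinearMap.adjoint_inner_right _ _ _

theorem integrable_charge_smul {ρ : E3 → ℝ} (hρ : IsTest ρ) (q : E3) (F : L2Field) :
    Integrable fun x => ρ (x - q) • F x := by
  have h1 : LocallyIntegrable F (volume : Measure E3) :=
    (Lp.memLp F).locallyIntegrable (by norm_num)
  exact h1.integrable_smul_left_of_hasCompactSupport
    (hρ.1.continuous.comp (continuous_sub_right q)) (hρ.2.comp_homeomorph (Homeomorph.subRight q))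

theorem chargeAvg_apply (q : E3) (F : L2Field) : chargeAvg hρ q F = ∫ x, ρ (x - q) • F x := by
  refine ext_inner_left ℝ fun w => ?_
  rw [inner_chargeAvg, inner_eq_pairing, pairing_congr (chargeOp_ae hρ q w) (ae_eq_refl _),
    ← integral_inner (integrable_charge_smul hρ q F)]
  refine integral_congr_ae (Eventually.of_forall fun x => ?_)
  simp only [inner_smul_left, inner_smul_right, RCLike.conj_to_real]

theorem force_eq {ρ : E3 → ℝ} (hρ : IsTest ρ) {φ : E3 → ℝ} {A : E3 → E3}
    (hP : ConditionP φ A) (Y : State) :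
    force ρ φ A Y = smear ρ (extE φ) Y.q + crossB Y.v (smear ρ (extB A) Y.q) +
      chargeAvg hρ Y.q Y.E + crossB Y.v (chargeAvg hρ Y.q Y.B) := by
  have hext : ∀ G : E3 → E3, BddLip G → Integrable fun x => ρ (x - Y.q) • G x := fun G hG =>
    ((hρ.1.continuous.comp (continuous_sub_right Y.q)).smul
      hG.continuous).integrable_of_hasCompactSupport
      (hρ.2.comp_homeomorph (Homeomorph.subRight Y.q)).smul_right
  have h1 := hext _ (bddLip_extE hP)
  have h2 := hext _ (bddLip_extB hP)
  have h3 := integrable_charge_smul hρ Y.q Y.E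
  have h4 := integrable_charge_smul hρ Y.q Y.B
  have h5 := (crossB Y.v).integrable_comp h2
  have h6 := (crossB Y.v).integrable_comp h4
  have h7 : Integrable fun x =>
      ρ (x - Y.q) • extE φ x + crossB Y.v (ρ (x - Y.q) • extB A x) := h1.add h5
  have h8 : Integrable fun x => ρ (x - Y.q) • extE φ x +
      crossB Y.v (ρ (x - Y.q) • extB A x) + ρ (x - Y.q) • Y.E x := h7.add h3
  rw [chargeAvg_apply, chargeAvg_apply, smear, smear, ← (crossB Y.v).integral_comp_comm h2,
    ← (crossB Y.v).integral_comp_comm h4, ← integral_add h1 h5, ← integral_add h7 h3,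
    ← integral_add h8 h6]
  refine integral_congr_ae (Eventually.of_forall fun x => ?_)
  simp only [map_smul, crossB_apply, smul_add]

end Charge

/-! ### Gradients and smeared potentials -/

theorem inner_gradient (f : E3 → ℝ) (x v : E3) : inner ℝ (gradient f x) v = fderiv ℝ f x v :=
  InnerProductSpace.toDual_symm_apply

theorem gradient_coord (f : E3 → ℝ) (x : E3) (j : Fin 3) :
    gradient f x j = fderiv ℝ f x (basisVec j) := by
  rw [← inner_gradient, EuclideanSpace.inner_single_right]
  simp

theorem IsTest.gradient {f : E3 → ℝ} (hf : IsTest f) : IsTest (gradient f) := by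
  refine ⟨contDiff_euclidean.2 fun j => ?_, (hf.2.fderiv ℝ).comp_left (map_zero _)⟩
  simp only [gradient_coord]
  exact (hf.fderiv_apply (basisVec j)).1

theorem partialD_gradient {f : E3 → ℝ} (hf : IsTest f) (i j : Fin 3) (x : E3) :
    partialD i j (gradient f) x = fderiv ℝ (fderiv ℝ f) x (basisVec i) (basisVec j) := by
  have h1 : HasFDerivAt (gradient f) (fderiv ℝ (gradient f) x) x :=
    (hf.gradient.1.differentiable (by simp) x).hasFDerivAt
  have h2 := (EuclideanSpace.proj (𝕜 := ℝ) j).hasFDerivAt.comp x h1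
  have h3 : (EuclideanSpace.proj (𝕜 := ℝ) j : E3 → ℝ) ∘ gradient f =
      fun y => fderiv ℝ f y (basisVec j) := funext fun y => gradient_coord f y j
  have h4 : HasFDerivAt (fderiv ℝ f) (fderiv ℝ (fderiv ℝ f) x) x :=
    ((hf.1.fderiv_right (m := ∞) (by simp)).differentiable (by simp) x).hasFDerivAt
  have h5 := h4.clm_apply (hasFDerivAt_const (basisVec j) x)
  rw [h3] at h2
  have h6 := congrArg (fun L : E3 →L[ℝ] ℝ => L (basisVec i)) (h2.unique h5)
  simpa [partialD] using h6

theorem curl_gradient {f : E3 → ℝ} (hf : IsTest f) : curl (gradient f) = fun _ => 0 := by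
  funext x
  have hs : IsSymmSndFDerivAt ℝ f x := hf.1.contDiffAt.isSymmSndFDerivAt (by
    simp only [minSmoothness_of_isRCLikeNormedField]
    exact WithTop.coe_le_coe.2 (le_top : (2 : ℕ∞) ≤ ⊤))
  have h : ∀ i j, partialD i j (gradient f) x = partialD j i (gradient f) x := fun i j => by
    rw [partialD_gradient hf, partialD_gradient hf, hs.eq]
  ext j
  fin_cases j
  · simp [curl, h 1 2]
  · simp [curl, h 2 0]
  · simp [curl, h 0 1]

/-- The potential energy `q ↦ ∫ ρ(x) f(x + q) dx` of a charge distribution changes along a curve at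
the rate `v · ∫ ρ(x - q) ∇f(x) dx`. -/
theorem hasDerivAt_integral_charge {ρ : E3 → ℝ} (hρ : IsTest ρ) {f : E3 → ℝ}
    (hf : ContDiff ℝ ∞ f) {C : ℝ} (hC : ∀ x, ‖fderiv ℝ f x‖ ≤ C) {q : ℝ → E3} {v : E3} {t : ℝ}
    (hq : HasDerivAt q v t) :
    HasDerivAt (fun s => ∫ x, ρ x * f (x + q s)) (inner ℝ (smear ρ (gradient f) (q t)) v) t := by
  have hfc : Continuous (fderiv ℝ f) := hf.continuous_fderiv (by simp)
  have hcont := hf.continuous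
  have hint1 : ∀ p, Integrable fun x => ρ x * f (x + p) := fun p =>
    hρ.integrable_smul (by fun_prop)
  have hint2 : ∀ p, Integrable fun x => ρ x • fderiv ℝ f (x + p) := fun p =>
    hρ.integrable_smul (by fun_prop)
  have hd : HasFDerivAt (fun p => ∫ x, ρ x * f (x + p)) (∫ x, ρ x • fderiv ℝ f (x + q t))
      (q t) := by
    refine hasFDerivAt_integral_of_dominated_of_fderiv_le (bound := fun x => ‖ρ x‖ * C)
      (F' := fun p x => ρ x • fderiv ℝ f (x + p))
      (s := Set.univ) Filter.univ_mem (Eventually.of_forall fun p => (hint1 p).aestronglyMeasurable)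
      (hint1 _) (hint2 _).aestronglyMeasurable (Eventually.of_forall fun x p _ => ?_) ?_
      (Eventually.of_forall fun x p _ => ?_)
    · rw [norm_smul]
      gcongr
      exact hC _
    · exact (hρ.1.continuous.integrable_of_hasCompactSupport hρ.2).norm.mul_const C
    · have h1 : HasFDerivAt f (fderiv ℝ f (x + p)) (x + p) :=
        (hf.differentiable (by simp) _).hasFDerivAt
      have h2 := h1.comp p ((hasFDerivAt_id p).const_add x)
      rw [ContinuousLinearMap.comp_id] at h2
      exact h2.const_mul (ρ x)
  have h := hd.comp_hasDerivAt t hq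
  refine h.congr_deriv ?_
  rw [ContinuousLinearMap.integral_apply (hint2 (q t)), smear_eq, real_inner_comm,
    ← integral_inner]
  · congr 1
    ext x
    rw [inner_smul_right, real_inner_comm, inner_gradient]
    rfl
  · have hg : Continuous (gradient f) :=
      (InnerProductSpace.toDual ℝ E3).symm.continuous.comp hfc
    exact hρ.integrable_smul (by fun_prop)

/-! ### The equations of motion in the interaction picture -/

theorem inner_maxwell_e (ψ χ : TestField) (F : Fields) :
    inner ℝ (maxwell.e (ψ, χ)) F = pairing ψ.1 F.fst + pairing χ.1 F.snd := by
  rw [Fields.inner_def, ← ψ.2.inner_toL2, ← χ.2.inner_toL2]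
  rfl

theorem inner_maxwell_a (ψ χ : TestField) (F : Fields) :
    inner ℝ (maxwell.a (ψ, χ)) F = pairing (curl χ.1) F.fst - pairing (curl ψ.1) F.snd := by
  rw [Fields.inner_def, ← ψ.2.curl.inner_toL2, ← χ.2.curl.inner_toL2, sub_eq_add_neg,
    ← inner_neg_left]
  rfl

theorem pairing_zero_left (F : E3 → E3) : pairing (fun _ => 0) F = 0 := by simp [pairing]

/-- The source `(-j, 0)` of Maxwell's equations that belongs to a current `j`. -/
noncomputable def source : L2Field →L[ℝ] Fields :=
  ((WithLp.prodContinuousLinearEquiv 2 ℝ L2Field L2Field).symm :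
      L2Field × L2Field →L[ℝ] Fields).comp
    (-ContinuousLinearMap.inl ℝ L2Field L2Field)

theorem source_fst (j : L2Field) : (source j).fst = -j := rfl

theorem source_snd (j : L2Field) : (source j).snd = 0 := by
  change -(0 : L2Field) = 0
  exact neg_zero

theorem norm_source (j : L2Field) : ‖source j‖ = ‖j‖ := by
  have h := Fields.norm_sq (source j)
  rw [source_fst, source_snd, norm_neg, norm_zero] at h
  exact (pow_left_inj₀ (norm_nonneg _) (norm_nonneg _) two_ne_zero).1 (by linarith)

/-- The electric field of a pair, as a bounded linear map. -/
noncomputable def fstCLM : Fields →L[ℝ] L2Field :=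
  (ContinuousLinearMap.fst ℝ L2Field L2Field).comp
    (WithLp.prodContinuousLinearEquiv 2 ℝ L2Field L2Field : Fields →L[ℝ] L2Field × L2Field)

/-- The magnetic field of a pair, as a bounded linear map. -/
noncomputable def sndCLM : Fields →L[ℝ] L2Field :=
  (ContinuousLinearMap.snd ℝ L2Field L2Field).comp
    (WithLp.prodContinuousLinearEquiv 2 ℝ L2Field L2Field : Fields →L[ℝ] L2Field × L2Field)

theorem norm_fst_le' (F : Fields) : ‖F.fst‖ ≤ ‖F‖ :=
  (pow_le_pow_iff_left₀ (norm_nonneg _) (norm_nonneg _) two_ne_zero).1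
    (by rw [Fields.norm_sq F]; nlinarith [sq_nonneg ‖F.snd‖])

theorem norm_snd_le' (F : Fields) : ‖F.snd‖ ≤ ‖F‖ :=
  (pow_le_pow_iff_left₀ (norm_nonneg _) (norm_nonneg _) two_ne_zero).1
    (by rw [Fields.norm_sq F]; nlinarith [sq_nonneg ‖F.fst‖])

/-- The variables `(G, q, u)` of the interaction picture: `G = U(-t) (E, B)` and `u = γ(v) v`. -/
abbrev Phase : Type := Fields × (E3 × E3)

section Dynamics

variable {ρ : E3 → ℝ} (hρ : IsTest ρ) (m : ℝ) (φ : E3 → ℝ) (A : E3 → E3)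

/-- The Lorentz force as a function of position, velocity and fields. -/
noncomputable def lorentz (q v : E3) (F : Fields) : E3 :=
  smear ρ (extE φ) q + crossB v (smear ρ (extB A) q) + chargeAvg hρ q F.fst +
    crossB v (chargeAvg hρ q F.snd)

/-- The current of a charge at `q` with momentum variable `u`. -/
noncomputable def currentOf (x : Phase) : L2Field := chargeOp hρ x.2.1 (vel x.2.2)

/-- The vector field of the equations of motion in the interaction picture. -/
noncomputable def vectorField (t : ℝ) (x : Phase) : Phase :=
  (maxwell.U (-t) (source (currentOf hρ x)),
    (vel x.2.2, m⁻¹ • lorentz hρ φ A x.2.1 (vel x.2.2) (maxwell.U t x.1)))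

/-- The state at time `t` with interaction picture variables `x`. -/
noncomputable def toState (t : ℝ) (x : Phase) : State :=
  ⟨(maxwell.U t x.1).fst, (maxwell.U t x.1).snd, x.2.1, vel x.2.2, norm_vel_lt _⟩

theorem toState_u (t : ℝ) (x : Phase) : (toState t x).u = x.2.2 := gammaFactor_smul_vel _

theorem force_toState {φ : E3 → ℝ} {A : E3 → E3} (hP : ConditionP φ A) (t : ℝ) (x : Phase) :
    force ρ φ A (toState t x) = lorentz hρ φ A x.2.1 (vel x.2.2) (maxwell.U t x.1) :=
  force_eq hρ hP _

theorem continuous_lorentz {φ : E3 → ℝ} {A : E3 → E3} (hP : ConditionP φ A) {X : Type*}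
    [TopologicalSpace X] {q v : X → E3} {F : X → Fields} (hq : Continuous q) (hv : Continuous v)
    (hF : Continuous F) : Continuous fun z => lorentz hρ φ A (q z) (v z) (F z) := by
  have h1 := ((bddLip_extE hP).smear hρ).continuous.comp hq
  have h2 := ((bddLip_extB hP).smear hρ).continuous.comp hq
  have h3 := (bddLip_chargeAvg hρ).continuous.comp hq
  have hE : Continuous fun z => (F z).fst := fstCLM.continuous.comp hF
  have hB : Continuous fun z => (F z).snd := sndCLM.continuous.comp hF
  exact ((h1.add ((crossB.continuous.comp hv).clm_apply h2)).add (h3.clm_apply hE)).add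
    ((crossB.continuous.comp hv).clm_apply (h3.clm_apply hB))

theorem continuous_vectorField_time {φ : E3 → ℝ} {A : E3 → E3} (hP : ConditionP φ A) (x : Phase) :
    Continuous fun t => vectorField hρ m φ A t x :=
  (maxwell.continuous_U_comp continuous_neg continuous_const).prodMk
    (continuous_const.prodMk (Continuous.const_smul (continuous_lorentz hρ hP
      (continuous_const (y := x.2.1)) (continuous_const (y := vel x.2.2))
      (maxwell.continuous_U_time x.1)) m⁻¹))

theorem bddLipOnBalls_vectorField {φ : E3 → ℝ} {A : E3 → E3} (hP : ConditionP φ A) :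
    BddLipOnBalls (vectorField hρ m φ A) := by
  have hG : BddLipOnBalls fun (_ : ℝ) (x : Phase) => x.1 :=
    bddLipOnBalls_clm (ContinuousLinearMap.fst ℝ Fields (E3 × E3))
  have hq : BddLipOnBalls fun (_ : ℝ) (x : Phase) => x.2.1 :=
    bddLipOnBalls_clm ((ContinuousLinearMap.fst ℝ E3 E3).comp
      (ContinuousLinearMap.snd ℝ Fields (E3 × E3)))
  have hu : BddLipOnBalls fun (_ : ℝ) (x : Phase) => x.2.2 :=
    bddLipOnBalls_clm ((ContinuousLinearMap.snd ℝ E3 E3).comp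
      (ContinuousLinearMap.snd ℝ Fields (E3 × E3)))
  have hv := hu.bddLip_comp bddLip_vel
  have hF : BddLipOnBalls fun (t : ℝ) (x : Phase) => maxwell.U t x.1 :=
    hG.isometry_comp maxwell.Uₗᵢ
  have hR := hq.bddLip_comp (bddLip_chargeAvg hρ)
  have hE := BddLipOnBalls.bilin (ContinuousLinearMap.id ℝ (L2Field →L[ℝ] E3)) hR
    (hF.clm_comp fstCLM)
  have hB := BddLipOnBalls.bilin (ContinuousLinearMap.id ℝ (L2Field →L[ℝ] E3)) hR
    (hF.clm_comp sndCLM)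
  have hj := BddLipOnBalls.bilin (ContinuousLinearMap.id ℝ (E3 →L[ℝ] L2Field))
    (hq.bddLip_comp (bddLip_chargeOp hρ)) hv
  have h1 := (hj.clm_comp source).isometry_comp fun t => maxwell.Uₗᵢ (-t)
  have h2 := ((((hq.bddLip_comp ((bddLip_extE hP).smear hρ)).add
    (BddLipOnBalls.bilin crossB hv (hq.bddLip_comp ((bddLip_extB hP).smear hρ)))).add hE).add
    (BddLipOnBalls.bilin crossB hv hB)).clm_comp (m⁻¹ • ContinuousLinearMap.id ℝ E3)
  exact h1.prodMk (hv.prodMk h2)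

theorem exists_vectorField_bound {φ : E3 → ℝ} {A : E3 → E3} (hP : ConditionP φ A) :
    ∃ c : ℝ, (∀ t x, ‖(vectorField hρ m φ A t x).1‖ ≤ c) ∧
      ∀ t x, ‖(vectorField hρ m φ A t x).2‖ ≤ c * (1 + ‖x.1‖) := by
  obtain ⟨a, ha⟩ := (bddLip_extE hP).smear hρ
  obtain ⟨b, hb⟩ := (bddLip_extB hP).smear hρ
  have ha0 : 0 ≤ a := (norm_nonneg _).trans (ha 0 0).1
  have hb0 : 0 ≤ b := (norm_nonneg _).trans (hb 0 0).1
  set r := ‖chargeOpZero hρ‖ with hr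
  set k := ‖crossB‖ with hk
  have hr0 : 0 ≤ r := norm_nonneg (chargeOpZero hρ)
  have hk0 : 0 ≤ k := norm_nonneg crossB
  have hcross : ∀ u w : E3, ‖crossB (vel u) w‖ ≤ k * ‖w‖ := fun u w => by
    refine (crossB.le_opNorm₂ _ _).trans ?_
    have := (norm_vel_lt u).le
    calc ‖crossB‖ * ‖vel u‖ * ‖w‖ ≤ ‖crossB‖ * 1 * ‖w‖ := by gcongr
      _ = k * ‖w‖ := by rw [mul_one]
  refine ⟨r + 1 + ‖m⁻¹‖ * (a + k * b + r + k * r), fun t x => ?_, fun t x => ?_⟩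
  · change ‖maxwell.U (-t) (source (currentOf hρ x))‖ ≤ _
    rw [maxwell.norm_U, norm_source]
    have h1 : ‖currentOf hρ x‖ ≤ r * 1 := by
      refine ((chargeOp hρ x.2.1).le_opNorm _).trans ?_
      gcongr
      · exact norm_chargeOp_le hρ _
      · exact (norm_vel_lt _).le
    have : 0 ≤ ‖m⁻¹‖ * (a + k * b + r + k * r) := by positivity
    linarith
  · have h1 : ‖lorentz hρ φ A x.2.1 (vel x.2.2) (maxwell.U t x.1)‖ ≤
        (a + k * b + r + k * r) * (1 + ‖x.1‖) := by
      have hR : ∀ F : L2Field, ‖F‖ ≤ ‖x.1‖ → ‖chargeAvg hρ x.2.1 F‖ ≤ r * ‖x.1‖ := fun F hF => by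
        refine ((chargeAvg hρ x.2.1).le_opNorm _).trans ?_
        gcongr
        exact norm_chargeAvg_le hρ _
      have hE := hR (maxwell.U t x.1).fst ((norm_fst_le' _).trans (maxwell.norm_U t x.1).le)
      have hB := hR (maxwell.U t x.1).snd ((norm_snd_le' _).trans (maxwell.norm_U t x.1).le)
      have h2 := (hcross x.2.2 (smear ρ (extB A) x.2.1)).trans
        (mul_le_mul_of_nonneg_left (hb x.2.1 0).1 hk0)
      have h3 := (hcross x.2.2 (chargeAvg hρ x.2.1 (maxwell.U t x.1).snd)).trans
        (mul_le_mul_of_nonneg_left hB hk0)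
      have h4 := norm_add₄_le (a := smear ρ (extE φ) x.2.1)
        (b := crossB (vel x.2.2) (smear ρ (extB A) x.2.1))
        (c := chargeAvg hρ x.2.1 (maxwell.U t x.1).fst)
        (d := crossB (vel x.2.2) (chargeAvg hρ x.2.1 (maxwell.U t x.1).snd))
      have h5 : 0 ≤ (a + k * b) * ‖x.1‖ := by positivity
      have h6 : 0 ≤ k * r := by positivity
      rw [lorentz]
      nlinarith [(ha x.2.1 0).1]
    refine max_le ?_ ?_
    · have h2 : 0 ≤ (r + ‖m⁻¹‖ * (a + k * b + r + k * r)) * (1 + ‖x.1‖) := by positivity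
      have h3 := (norm_vel_lt x.2.2).le
      change ‖vel x.2.2‖ ≤ _
      nlinarith [norm_nonneg x.1]
    · change ‖m⁻¹ • lorentz hρ φ A x.2.1 (vel x.2.2) (maxwell.U t x.1)‖ ≤ _
      rw [norm_smul]
      calc ‖m⁻¹‖ * ‖lorentz hρ φ A x.2.1 (vel x.2.2) (maxwell.U t x.1)‖
          ≤ ‖m⁻¹‖ * ((a + k * b + r + k * r) * (1 + ‖x.1‖)) := by gcongr
        _ ≤ (r + 1) * (1 + ‖x.1‖) + ‖m⁻¹‖ * ((a + k * b + r + k * r) * (1 + ‖x.1‖)) :=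
            le_add_of_nonneg_left (by positivity)
        _ = _ := by ring

end Dynamics

section Dynamics

variable {ρ : E3 → ℝ} (hρ : IsTest ρ) (m : ℝ) {φ : E3 → ℝ} {A : E3 → E3}

/-! ### From the interaction picture to the equations of motion -/

theorem continuous_state_iff {X : Type*} [TopologicalSpace X] {Y : X → State} :
    Continuous Y ↔ Continuous (fun z => (Y z).E) ∧ Continuous (fun z => (Y z).B) ∧
      Continuous (fun z => (Y z).q) ∧ Continuous (fun z => (Y z).u) := by
  have hdist : ∀ a b : State, dist a b =
      dist a.E b.E + dist a.B b.B + dist a.q b.q + dist a.u b.u := fun a b => by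
    simp only [dist_eq_norm]
    rfl
  constructor
  · intro h
    have aux : ∀ {W : Type} [NormedAddCommGroup W] (g : State → W),
        (∀ a b, dist (g a) (g b) ≤ dist a b) → Continuous fun z => g (Y z) := fun g hg =>
      (LipschitzWith.of_dist_le_mul (K := 1) fun a b => by
        simpa using hg a b).continuous.comp h
    have hnn : ∀ a b : State, 0 ≤ dist a.E b.E ∧ 0 ≤ dist a.B b.B ∧ 0 ≤ dist a.q b.q ∧
        0 ≤ dist a.u b.u := fun a b => ⟨dist_nonneg, dist_nonneg, dist_nonneg, dist_nonneg⟩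
    refine ⟨aux _ fun a b => ?_, aux _ fun a b => ?_, aux _ fun a b => ?_, aux _ fun a b => ?_⟩ <;>
    · obtain ⟨h1, h2, h3, h4⟩ := hnn a b
      rw [hdist a b]
      linarith
  · rintro ⟨hE, hB, hq, hu⟩
    rw [continuous_iff_continuousAt]
    intro z
    rw [ContinuousAt, tendsto_iff_dist_tendsto_zero]
    simp only [hdist]
    have hc : Continuous fun w => dist (Y w).E (Y z).E + dist (Y w).B (Y z).B +
        dist (Y w).q (Y z).q + dist (Y w).u (Y z).u := by fun_prop
    simpa using hc.tendsto z

theorem continuous_state_v {X : Type*} [TopologicalSpace X] {Y : X → State}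
    (h : Continuous fun z => (Y z).u) : Continuous fun z => (Y z).v := by
  have h1 : (fun z => (Y z).v) = fun z => vel (Y z).u :=
    funext fun z => (vel_gammaFactor_smul (Y z).v_lt).symm
  rw [h1]
  exact bddLip_vel.continuous.comp h

theorem pairing_chargeOp (ψ : E3 → E3) (Y : State) :
    pairing ψ (chargeOp hρ Y.q Y.v) = pairing ψ (current ρ Y) :=
  pairing_congr (ae_eq_refl _) (chargeOp_ae hρ _ _)

theorem pairing_currentOf (ψ : E3 → E3) (t : ℝ) (x : Phase) :
    pairing ψ (currentOf hρ x) = pairing ψ (current ρ (toState t x)) :=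
  pairing_chargeOp hρ ψ (toState t x)

variable {x : ℝ → Phase} (hx : ∀ t, HasDerivAt x (vectorField hρ m φ A t (x t)) t)

/-- The initial values of the interaction picture variables of a state. -/
noncomputable def phaseOf (Y : State) : Phase := (WithLp.toLp 2 (Y.E, Y.B), (Y.q, Y.u))

theorem toState_zero (Y : State) : toState 0 (phaseOf Y) = Y := by
  apply State.ext
  · change (maxwell.U 0 (WithLp.toLp 2 (Y.E, Y.B))).fst = Y.E
    rw [maxwell.U_zero, WithLp.toLp_fst]
  · change (maxwell.U 0 (WithLp.toLp 2 (Y.E, Y.B))).snd = Y.B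
    rw [maxwell.U_zero, WithLp.toLp_snd]
  · rfl
  · exact vel_gammaFactor_smul Y.v_lt

include hx

theorem continuous_solution : Continuous x :=
  continuous_iff_continuousAt.2 fun t => (hx t).continuousAt

theorem hasDerivAt_fields (t : ℝ) :
    HasDerivAt (fun s => (x s).1) (maxwell.U (-t) (source (currentOf hρ (x t)))) t :=
  (hx t).fst

theorem hasDerivAt_position (t : ℝ) : HasDerivAt (fun s => (x s).2.1) (vel (x t).2.2) t :=
  (hx t).snd.fst

theorem hasDerivAt_momentum (t : ℝ) : HasDerivAt (fun s => (x s).2.2)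
    (m⁻¹ • lorentz hρ φ A (x t).2.1 (vel (x t).2.2) (maxwell.U t (x t).1)) t :=
  (hx t).snd.snd

theorem continuous_toState : Continuous fun t => toState t (x t) := by
  have hxc := continuous_solution hρ m hx
  have hF : Continuous fun t => maxwell.U t (x t).1 :=
    maxwell.continuous_U_comp continuous_id (continuous_fst.comp hxc)
  refine continuous_state_iff.2 ⟨fstCLM.continuous.comp hF, sndCLM.continuous.comp hF,
    continuous_fst.comp (continuous_snd.comp hxc), ?_⟩
  simp only [toState_u]
  exact continuous_snd.comp (continuous_snd.comp hxc)

theorem hasDerivAt_pairing_E {ψ : E3 → E3} (hψ : IsTest ψ) (t : ℝ) :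
    HasDerivAt (fun s => pairing ψ (toState s (x s)).E)
      (pairing (curl ψ) (toState t (x t)).B - pairing ψ (current ρ (toState t (x t)))) t := by
  have h := maxwell.hasDerivAt_inner_U (hasDerivAt_fields hρ m hx t)
    (⟨ψ, hψ⟩, ⟨_, isTest_zero⟩)
  simp only [inner_maxwell_e, inner_maxwell_a, curl_zero, pairing_zero_left, add_zero, zero_sub,
    neg_neg, source_fst] at h
  have h1 : pairing ψ ((-currentOf hρ (x t) : L2Field) : E3 → E3) =
      -pairing ψ (current ρ (toState t (x t))) := by
    rw [← hψ.inner_toL2, inner_neg_right, hψ.inner_toL2, pairing_currentOf hρ ψ t]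
  rw [h1, ← sub_eq_add_neg] at h
  exact h

theorem hasDerivAt_pairing_B {ψ : E3 → E3} (hψ : IsTest ψ) (t : ℝ) :
    HasDerivAt (fun s => pairing ψ (toState s (x s)).B)
      (-pairing (curl ψ) (toState t (x t)).E) t := by
  have h := maxwell.hasDerivAt_inner_U (hasDerivAt_fields hρ m hx t)
    (⟨_, isTest_zero⟩, ⟨ψ, hψ⟩)
  simp only [inner_maxwell_e, inner_maxwell_a, curl_zero, pairing_zero_left, zero_add, sub_zero,
    source_snd] at h
  have h1 : pairing ψ ((0 : L2Field) : E3 → E3) = 0 := by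
    rw [← hψ.inner_toL2, inner_zero_right]
  rw [h1, add_zero] at h
  exact h

theorem hasDerivAt_integral_charge_position {f : E3 → ℝ} (hf : ContDiff ℝ ∞ f) {C : ℝ}
    (hC : ∀ z, ‖fderiv ℝ f z‖ ≤ C) (t : ℝ) :
    HasDerivAt (fun s => ∫ z, ρ z * f (z + (x s).2.1))
      (inner ℝ (smear ρ (gradient f) (x t).2.1) (vel (x t).2.2)) t :=
  hasDerivAt_integral_charge hρ hf hC (hasDerivAt_position hρ m hx t)

/-- Gauss' law is preserved: both sides, tested against `f`, change by the current through the
gradient of `f`. -/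
theorem toState_mem_phaseSpace (h0 : toState 0 (x 0) ∈ phaseSpace ρ) (t : ℝ) :
    toState t (x t) ∈ phaseSpace ρ := by
  constructor
  · intro f hf
    obtain ⟨C, hC⟩ := (hf.2.fderiv ℝ).exists_bound_of_continuous
      (hf.1.continuous_fderiv (by simp))
    have hint : ∀ q : E3, ∫ z, f z * ρ (z - q) = ∫ z, ρ z * f (z + q) := fun q => by
      rw [← integral_add_right_eq_self _ q]
      simp only [add_sub_cancel_right, mul_comm]
    have hcur : ∀ s, pairing (gradient f) (current ρ (toState s (x s))) =
        inner ℝ (smear ρ (gradient f) (x s).2.1) (vel (x s).2.2) := fun s => by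
      have hi : Integrable fun z => ρ (z - (x s).2.1) • gradient f z :=
        ((hρ.1.continuous.comp (continuous_sub_right _)).smul
          hf.gradient.1.continuous).integrable_of_hasCompactSupport hf.gradient.2.smul_left
      rw [smear, real_inner_comm, ← integral_inner hi]
      refine integral_congr_ae (Eventually.of_forall fun z => ?_)
      simp only [current, toState, inner_smul_right]
      rw [real_inner_comm]
    have hd : ∀ s, HasDerivAt (fun s => pairing (gradient f) (toState s (x s)).E +
        ∫ z, ρ z * f (z + (x s).2.1)) 0 s := fun s => by
      have h1 := (hasDerivAt_pairing_E hρ m hx hf.gradient s).add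
        (hasDerivAt_integral_charge_position hρ m hx hf.1 hC s)
      rw [curl_gradient hf, pairing_zero_left, hcur, zero_sub, neg_add_cancel] at h1
      exact h1
    have hconst := is_const_of_deriv_eq_zero (fun s => (hd s).differentiableAt)
      (fun s => (hd s).deriv) t 0
    have h1 := h0.1 f hf
    rw [hint] at h1 ⊢
    change -pairing (gradient f) (toState t (x t)).E = ∫ z, ρ z * f (z + (x t).2.1)
    change -pairing (gradient f) (toState 0 (x 0)).E = ∫ z, ρ z * f (z + (x 0).2.1) at h1
    linarith [hconst]
  · intro f hf
    have hd : ∀ s, HasDerivAt (fun s => pairing (gradient f) (toState s (x s)).B) 0 s := by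
      intro s
      have h1 := hasDerivAt_pairing_B hρ m hx hf.gradient s
      rw [curl_gradient hf, pairing_zero_left, neg_zero] at h1
      exact h1
    have hconst := is_const_of_deriv_eq_zero (fun s => (hd s).differentiableAt)
      (fun s => (hd s).deriv) t 0
    exact (congrArg Neg.neg hconst).trans (h0.2 f hf)

end Dynamics

theorem continuous_pairing {X : Type*} [TopologicalSpace X] {F : X → L2Field}
    (hF : Continuous F) {ψ : E3 → E3} (hψ : IsTest ψ) : Continuous fun z => pairing ψ (F z) := by
  simp only [← hψ.inner_toL2]
  exact continuous_const.inner hF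

section Dynamics

variable {ρ : E3 → ℝ} (hρ : IsTest ρ) (m : ℝ) {φ : E3 → ℝ} {A : E3 → E3}

theorem continuous_chargeOp {Y : ℝ → State} (hY : Continuous Y) :
    Continuous fun t => chargeOp hρ (Y t).q (Y t).v := by
  obtain ⟨-, -, hq, hu⟩ := continuous_state_iff.1 hY
  exact ((bddLip_chargeOp hρ).continuous.comp hq).clm_apply (continuous_state_v hu)

theorem continuous_pairing_current {ρ : E3 → ℝ} (hρ : IsTest ρ) {Y : ℝ → State}
    (hY : Continuous Y) {ψ : E3 → E3} (hψ : IsTest ψ) :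
    Continuous fun t => pairing ψ (current ρ (Y t)) := by
  simp only [← pairing_chargeOp hρ]
  exact continuous_pairing (continuous_chargeOp hρ hY) hψ

theorem continuous_toLp {Y : ℝ → State} (hY : Continuous Y) :
    Continuous fun t => (WithLp.toLp 2 ((Y t).E, (Y t).B) : Fields) := by
  obtain ⟨hE, hB, -, -⟩ := continuous_state_iff.1 hY
  exact (WithLp.prodContinuousLinearEquiv 2 ℝ L2Field L2Field).symm.continuous.comp
    (hE.prodMk hB)

theorem continuous_force {ρ : E3 → ℝ} (hρ : IsTest ρ) (hP : ConditionP φ A)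
    {Y : ℝ → State} (hY : Continuous Y) : Continuous fun t => force ρ φ A (Y t) := by
  obtain ⟨-, -, hq, hu⟩ := continuous_state_iff.1 hY
  have h := continuous_lorentz hρ hP hq (continuous_state_v hu) (continuous_toLp hY)
  have h1 : (fun t => force ρ φ A (Y t)) = fun t => lorentz hρ φ A (Y t).q (Y t).v
      (WithLp.toLp 2 ((Y t).E, (Y t).B)) := funext fun t => force_eq hρ hP (Y t)
  rw [h1]
  exact h

theorem solvesIntegrated_toState (hm : 0 < m) (hP : ConditionP φ A) {x : ℝ → Phase}
    (hx : ∀ t, HasDerivAt x (vectorField hρ m φ A t (x t)) t) {Y₀ : State}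
    (h0 : toState 0 (x 0) = Y₀) :
    SolvesIntegrated ρ m φ A Y₀ fun t => toState t (x t) := by
  have hc := continuous_toState hρ m hx
  obtain ⟨hE, hB, hq, hu⟩ := continuous_state_iff.1 hc
  constructor
  · intro t ψ hψ
    rw [intervalIntegral.integral_eq_sub_of_hasDerivAt
      (fun s _ => hasDerivAt_pairing_B hρ m hx hψ s)
      ((continuous_pairing hE hψ.curl).neg.intervalIntegrable _ _), h0]
    ring
  · intro t ψ hψ
    rw [intervalIntegral.integral_eq_sub_of_hasDerivAt
      (fun s _ => hasDerivAt_pairing_E hρ m hx hψ s)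
      (((continuous_pairing hB hψ.curl).sub
        (continuous_pairing_current hρ hc hψ)).intervalIntegrable _ _), h0]
    ring
  · intro t
    have h1 := intervalIntegral.integral_eq_sub_of_hasDerivAt
      (fun s _ => hasDerivAt_position hρ m hx s)
      ((continuous_state_v hu).intervalIntegrable 0 t)
    change (x t).2.1 = _ + ∫ s in (0 : ℝ)..t, vel (x s).2.2
    rw [h1, ← h0]
    exact (add_sub_cancel _ _).symm
  · intro t
    have hd : ∀ s, HasDerivAt (fun s => m • (x s).2.2) (force ρ φ A (toState s (x s))) s := by
      intro s
      have h1 := (hasDerivAt_momentum hρ m hx s).const_smul m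
      rw [smul_inv_smul₀ hm.ne', ← force_toState hρ hP] at h1
      exact h1
    have h1 := intervalIntegral.integral_eq_sub_of_hasDerivAt (fun s _ => hd s)
      ((continuous_force hρ hP hc).intervalIntegrable 0 t)
    change m • (toState t (x t)).u = m • Y₀.u + _
    rw [h1, ← h0, toState_u, toState_u]
    exact (add_sub_cancel _ _).symm

/-! ### Uniqueness -/

/-- Every weak solution of the equations of motion comes from a solution of the differential
equation in the interaction picture. -/
theorem exists_phase_of_solvesIntegrated (hm : 0 < m) (hP : ConditionP φ A) {Y₀ : State}
    {Z : ℝ → State} (hZ : Continuous Z) (hs : SolvesIntegrated ρ m φ A Y₀ Z) :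
    ∃ x : ℝ → Phase, x 0 = phaseOf Y₀ ∧
      (∀ t, HasDerivAt x (vectorField hρ m φ A t (x t)) t) ∧ ∀ t, Z t = toState t (x t) := by
  obtain ⟨hE, hB, hq, hu⟩ := continuous_state_iff.1 hZ
  have hv := continuous_state_v hu
  have hJ : Continuous fun t => source (chargeOp hρ (Z t).q (Z t).v) :=
    source.continuous.comp (continuous_chargeOp hρ hZ)
  have hUJ := maxwell.continuous_U_comp continuous_neg hJ
  have hmild := maxwell.eq_duhamel_of_weak (continuous_toLp hZ) hJ
    (x := WithLp.toLp 2 (Y₀.E, Y₀.B)) (by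
      rintro t ⟨⟨ψ, hψ⟩, ⟨χ, hχ⟩⟩
      have h1 : ∀ s, pairing ψ ((-chargeOp hρ (Z s).q (Z s).v : L2Field) : E3 → E3) =
          -pairing ψ (current ρ (Z s)) := fun s => by
        rw [← hψ.inner_toL2, inner_neg_right, hψ.inner_toL2, pairing_chargeOp hρ]
      have h2 : pairing χ ((0 : L2Field) : E3 → E3) = 0 := by
        rw [← hχ.inner_toL2, inner_zero_right]
      simp only [inner_maxwell_e, inner_maxwell_a, WithLp.toLp_fst, WithLp.toLp_snd, source_fst,
        source_snd, h1, h2, add_zero]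
      rw [hs.ampere t ψ hψ, hs.faraday t χ hχ, add_add_add_comm,
        ← intervalIntegral.integral_add]
      · congr 2
        ext s
        ring
      · exact ((continuous_pairing hB hψ.curl).sub
          (continuous_pairing_current hρ hZ hψ)).intervalIntegrable _ _
      · exact (continuous_pairing hE hχ.curl).neg.intervalIntegrable _ _)
  obtain ⟨G, hG⟩ : ∃ G : ℝ → Fields, ∀ t, G t = WithLp.toLp 2 (Y₀.E, Y₀.B) +
      ∫ s in (0 : ℝ)..t, maxwell.U (-s) (source (chargeOp hρ (Z s).q (Z s).v)) :=
    ⟨_, fun _ => rfl⟩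
  have hGd : ∀ t, HasDerivAt G (maxwell.U (-t) (source (chargeOp hρ (Z t).q (Z t).v))) t := by
    intro t
    rw [funext hG]
    exact (hUJ.integral_hasStrictDerivAt 0 t).hasDerivAt.const_add _
  have hqd : ∀ t, HasDerivAt (fun s => (Z s).q) (Z t).v t := by
    intro t
    simp only [hs.position]
    exact (hv.integral_hasStrictDerivAt 0 t).hasDerivAt.const_add _
  have hu_eq : ∀ t, (Z t).u = Y₀.u + m⁻¹ • ∫ s in (0 : ℝ)..t, force ρ φ A (Z s) := by
    intro t
    have h1 : m • (Z t).u = m • Y₀.u + ∫ s in (0 : ℝ)..t, force ρ φ A (Z s) := hs.momentum t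
    rw [← inv_smul_smul₀ hm.ne' (Z t).u, h1, smul_add, inv_smul_smul₀ hm.ne']
  have hud : ∀ t, HasDerivAt (fun s => (Z s).u) (m⁻¹ • force ρ φ A (Z t)) t := by
    intro t
    simp only [hu_eq]
    exact (((continuous_force hρ hP hZ).integral_hasStrictDerivAt 0 t).hasDerivAt.const_smul
      m⁻¹).const_add _
  have hvel : ∀ t, vel (Z t).u = (Z t).v := fun t => vel_gammaFactor_smul (Z t).v_lt
  have hUG : ∀ t, maxwell.U t (G t) = WithLp.toLp 2 ((Z t).E, (Z t).B) := fun t => by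
    rw [hG, ← hmild]
  refine ⟨fun t => (G t, ((Z t).q, (Z t).u)), ?_, fun t => ?_, fun t => ?_⟩
  · have hq0 : (Z 0).q = Y₀.q := by simpa using hs.position 0
    have hu0 : (Z 0).u = Y₀.u := by simpa using hu_eq 0
    have hG0 : G 0 = WithLp.toLp 2 (Y₀.E, Y₀.B) := by simpa using hG 0
    simp only [hq0, hu0, hG0]
    rfl
  · refine ((hGd t).prodMk ((hqd t).prodMk (hud t))).congr_deriv ?_
    simp only [vectorField, currentOf, hvel, hUG, force_eq hρ hP]
    rfl
  · apply State.ext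
    · exact (congrArg (fun F : Fields => F.fst) (hUG t)).symm
    · exact (congrArg (fun F : Fields => F.snd) (hUG t)).symm
    · rfl
    · exact (hvel t).symm

/-! ### Conservation of energy -/

theorem integral_norm_sq (F : L2Field) : ∫ x, ‖F x‖ ^ 2 = ‖F‖ ^ 2 := by
  rw [← real_inner_self_eq_norm_sq, inner_eq_pairing, pairing]
  simp only [real_inner_self_eq_norm_sq]

theorem integrable_norm_sq (F : L2Field) : Integrable fun x => ‖F x‖ ^ 2 :=
  (Lp.memLp F).integrable_norm_pow two_ne_zero

theorem energy_toState (hρ_even : ∀ x, ρ (-x) = ρ x) (t : ℝ) (x : Phase) :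
    energy ρ m φ (toState t x) = m * Real.sqrt (1 + ‖x.2.2‖ ^ 2) +
      (∫ z, ρ z * φ (z + x.2.1)) + 1 / 2 * ‖x.1‖ ^ 2 := by
  have h1 : ∫ y, φ ((toState t x).q - y) * ρ y = ∫ z, ρ z * φ (z + x.2.1) := by
    rw [← integral_neg_eq_self]
    congr 1
    ext z
    rw [hρ_even, sub_neg_eq_add, mul_comm, add_comm z]
    rfl
  rw [energy, h1, integral_add (integrable_norm_sq _) (integrable_norm_sq _), integral_norm_sq,
    integral_norm_sq]
  have h2 := Fields.norm_sq (maxwell.U t x.1)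
  rw [maxwell.norm_U] at h2
  rw [h2]
  congr 3
  exact gammaFactor_vel _

theorem energy_conserved (hm : 0 < m) (hP : ConditionP φ A) (hρ_even : ∀ x, ρ (-x) = ρ x)
    {x : ℝ → Phase} (hx : ∀ t, HasDerivAt x (vectorField hρ m φ A t (x t)) t) (t : ℝ) :
    energy ρ m φ (toState t (x t)) = energy ρ m φ (toState 0 (x 0)) := by
  obtain ⟨C, hC⟩ := hP.bounded
  have hd : ∀ s, HasDerivAt (fun s => m * Real.sqrt (1 + ‖(x s).2.2‖ ^ 2) +
      (∫ z, ρ z * φ (z + (x s).2.1)) + 1 / 2 * ‖(x s).1‖ ^ 2) 0 s := by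
    intro s
    have h1 := (((hasDerivAt_momentum hρ m hx s).norm_sq.const_add 1).sqrt
      (by positivity)).const_mul m
    have h2 := hasDerivAt_integral_charge_position hρ m hx hP.smooth_phi (C := C)
      (fun z => by rw [← norm_iteratedFDeriv_one]; exact (hC 1 le_rfl (by norm_num) z).1) s
    have h3 := (hasDerivAt_fields hρ m hx s).norm_sq.const_mul (1 / 2 : ℝ)
    refine ((h1.add h2).add h3).congr_deriv ?_
    set v := vel (x s).2.2 with hv
    set q := (x s).2.1 with hq
    set F := maxwell.U s (x s).1 with hF
    -- The rate of change of the kinetic energy is the power `v · force` of the Lorentz force, to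
    -- which the magnetic terms do not contribute.
    have hkin : m * (2 * inner ℝ (x s).2.2 (m⁻¹ • lorentz hρ φ A q v F) /
        (2 * Real.sqrt (1 + ‖(x s).2.2‖ ^ 2))) =
        inner ℝ v (smear ρ (extE φ) q) + inner ℝ v (chargeAvg hρ q F.fst) := by
      have h4 : inner ℝ v (lorentz hρ φ A q v F) =
          inner ℝ v (smear ρ (extE φ) q) + inner ℝ v (chargeAvg hρ q F.fst) := by
        rw [lorentz, inner_add_right, inner_add_right, inner_add_right, inner_crossB_self,
          inner_crossB_self, add_zero, add_zero]
      rw [← h4, hv, vel, inner_smul_left, inner_smul_right, RCLike.conj_to_real]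
      have := (sqrt_one_add_pos (x s).2.2).ne'
      field_simp
    have hpot : smear ρ (extE φ) q = -smear ρ (gradient φ) q := by
      rw [smear, smear, ← integral_neg]
      simp only [extE, smul_neg]
    have hfield : inner ℝ (x s).1 (maxwell.U (-s) (source (currentOf hρ (x s)))) =
        -inner ℝ v (chargeAvg hρ q F.fst) := by
      rw [maxwell.inner_U_right, neg_neg, Fields.inner_def, source_fst, source_snd,
        inner_zero_right, add_zero, inner_neg_right, inner_chargeAvg, real_inner_comm]
      rfl
    rw [hkin, hpot, hfield, inner_neg_right, real_inner_comm v]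
    ring
  have hconst := is_const_of_deriv_eq_zero (fun s => (hd s).differentiableAt)
    (fun s => (hd s).deriv) t 0
  rw [energy_toState m hρ_even, energy_toState m hρ_even]
  exact hconst

end Dynamics

end AbrahamModel

theorem theorem1p1 (ρ : AbrahamModel.E3 → ℝ) (R e m : ℝ) (φ : AbrahamModel.E3 → ℝ)
    (A : AbrahamModel.E3 → AbrahamModel.E3)
    (hm : 0 < m) (hC : AbrahamModel.ConditionC ρ R e) (hP : AbrahamModel.ConditionP φ A)
    (Y₀ : AbrahamModel.State) (hY₀ : Y₀ ∈ AbrahamModel.phaseSpace ρ) :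
    ∃ Y : ℝ → AbrahamModel.State,
      ((∀ t, Y t ∈ AbrahamModel.phaseSpace ρ) ∧ Continuous Y ∧
        AbrahamModel.SolvesIntegrated ρ m φ A Y₀ Y) ∧
      (∀ Z : ℝ → AbrahamModel.State,
        (∀ t, Z t ∈ AbrahamModel.phaseSpace ρ) → Continuous Z →
        AbrahamModel.SolvesIntegrated ρ m φ A Y₀ Z → Z = Y) ∧
      Y 0 = Y₀ ∧
      ∀ t, AbrahamModel.energy ρ m φ (Y t) = AbrahamModel.energy ρ m φ Y₀ := by
  have hρ := hC.isTest
  have hρ_even : ∀ x, ρ (-x) = ρ x := by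
    obtain ⟨ρr, hr⟩ := hC.radial
    intro x
    rw [hr, hr, norm_neg]
  have hlip := (AbrahamModel.bddLipOnBalls_vectorField hρ m hP).lipschitzOnWith
  obtain ⟨c, h1, h2⟩ := AbrahamModel.exists_vectorField_bound hρ m hP
  obtain ⟨x, hx0, hx⟩ := GlobalODE.exists_global
    (AbrahamModel.continuous_vectorField_time hρ m hP) hlip h1 h2 (AbrahamModel.phaseOf Y₀)
  have h0 : AbrahamModel.toState 0 (x 0) = Y₀ := by rw [hx0, AbrahamModel.toState_zero]
  refine ⟨fun t => AbrahamModel.toState t (x t),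
    ⟨AbrahamModel.toState_mem_phaseSpace hρ m hx (h0 ▸ hY₀),
      AbrahamModel.continuous_toState hρ m hx,
      AbrahamModel.solvesIntegrated_toState hρ m hm hP hx h0⟩,
    fun Z _ hZc hZ => ?_, h0, fun t => ?_⟩
  · obtain ⟨y, hy0, hy, hZy⟩ :=
      AbrahamModel.exists_phase_of_solvesIntegrated hρ m hm hP hZc hZ
    rw [GlobalODE.unique hlip hx hy (hx0.trans hy0.symm)]
    exact funext hZy
  · rw [AbrahamModel.energy_conserved hρ m hm hP hρ_even hx t, h0]
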